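/- Definitions. A quasigroup is a set with a binary operation all of whose left and right multiplication maps are bijective. Two quasigroups $(Q,\cdot)$ and $(R,\circ)$ are isostrophic (belong to the same main class) if there are $\sigma\in S_3$ and bijections $\gamma_1,\gamma_2,\gamma_3:Q\to R$ such that for all $x_1,x_2,x_3\in Q$ one has $x_{\sigma(1)}\cdot x_{\sigma(2)}=x_{\sigma(3)}$ if and only if $\gamma_1(x_1)\circ\gamma_2(x_2)=\gamma_3(x_3)$. An abstract light dual multinet labeled by the quasigroup $Q$ is a pair $(\mathcal P,\mathcal M)$, where $\mathcal M$ is a set of subsets of $\mathcal P$ (called lines), such that: (1) $\mathcal P$ is the disjoint union of subsets $\mathcal P_1,\mathcal P_2,\mathcal P_3$; (2) any two distinct points of $\mathcal P$ are contained in at most one line, and every line meets at least two of $\mathcal P_1,\mathcal P_2,\mathcal P_3$; (3) there are bijections $\alpha_i:Q\to\mathcal P_i$ $(i=1,2,3)$ such that for all $x,y\in Q$ some line contains $\alpha_1(x)$, $\alpha_2(y)$ and $\alpha_3(x\cdot y)$; (4) $|\mathcal M|>1$. Its order is $|Q|$. For finite $Q$, each line $B$ satisfies $|B\cap\mathcal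 P_1|=|B\cap\mathcal P_2|=|B\cap\mathcal P_3|\ge 1$; this number is the length of $B$. A superline is a line of length greater than $1$. An isomorphism $(\mathcal P,\mathcal M)\to(\mathcal P',\mathcal M')$ is a bijection $\mathcal P\to\mathcal P'$ that induces a bijection $\mathcal M\to\mathcal M'$ (it need not respect the three components); automorphisms are defined accordingly. The Dénes–Keedwell numbers $6.1,\dots,6.12$ denote the twelve main classes of quasigroups of order $6$, represented by the following Latin squares (Cayley tables on $\{1,\dots,6\}$, rows separated by slashes): - $6.1$: 123456 / 234561 / 345612 / 456123 / 561234 / 612345 - $6.2$: 123456 / 215634 / 361542 / 456123 / 542361 / 634215 - $6.3$: 123456 / 231564 / 312645 / 465213 / 546321 / 654132 - $6.4$: 123456 / 214365 / 345612 / 436521 / 561243 / 652134 - $6.5$: 123456 / 215634 / 362541 / 456213 / 541362 / 634125 - $6.6$: 123456 / 214563 / 362145 / 456231 / 531624 / 645312 - $6.7$: 123456 / 214365 / 351642 / 465123 / 536214 / 642531 - $6.8$: 123456 / 216534 / 361245 / 452163 / 534612 / 645321 - $6.9$: 123456 / 231645 / 312564 / 465123 / 546231 / 654312 - $6.10$: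 123456 / 216543 / 351264 / 462135 / 534621 / 645312 - $6.11$: 123456 / 214563 / 342615 / 456231 / 561324 / 635142 - $6.12$: 123456 / 215643 / 354261 / 462315 / 546132 / 631524 Theorem. Up to isomorphism there are exactly $16$ abstract light dual multinets of order $6$ with a unique superline. They can be numbered $M_1,\dots,M_{16}$ such that for each $i$ the length of the superline of $M_i$, the set of Dénes–Keedwell numbers of the quasigroups by which $M_i$ can be labeled (that is, a quasigroup labels $M_i$ if and only if it belongs to one of the listed main classes), and the isomorphism type of the automorphism group of $M_i$ are as follows, where $D_8$ is the dihedral group of order $8$. | | length | labeling quasigroups | automorphism group | |---|---|---|---| | $M_1$ | 3 | 6.1, 6.9 | $((C_3\times C_3\times C_3):C_3):(C_2\times C_2)$ | | $M_2$ | 3 | 6.2, 6.3, 6.9 | $((C_3\times C_3\times C_3):C_3):(C_2\times C_2)$ | | $M_3$ | 2 | 6.1, 6.4 | $C_2\times S_4$ | | $M_4$ | 2 | 6.2, 6.5 | $C_2\times S_4$ | | $M_5$ | 2 | 6.4 | $C_2\times S_4$ | | $M_6$ | 2 | 6.7 | $C_2\times S_4$ | | $M_7$ | 2 | 6.5 |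 $C_2\times D_8$ | | $M_8$ | 2 | 6.8, 6.11 | $C_2\times D_8$ | | $M_9$ | 2 | 6.10 | $C_2\times D_8$ | | $M_{10}$ | 2 | 6.11 | $C_2\times D_8$ | | $M_{11}$ | 2 | 6.9, 6.12 | $C_2\times C_2\times C_2$ | | $M_{12}$ | 2 | 6.12 | $C_2\times C_2\times C_2$ | | $M_{13}$ | 2 | 6.6, 6.7 | $S_3$ | | $M_{14}$ | 2 | 6.5, 6.10 | $C_2\times C_2$ | | $M_{15}$ | 2 | 6.7, 6.10 | $C_2\times C_2$ | | $M_{16}$ | 2 | 6.11, 6.12 | $C_2\times C_2$ | Here $N:H$ denotes a semidirect product. In the group of order $324$ the factor $C_3$ permutes the three coordinates of $C_3\times C_3\times C_3$ cyclically; in $C_2\times C_2$, the first factor inverts every element of $C_3\times C_3\times C_3$ and centralizes the factor $C_3$, and the second factor inverts the factor $C_3$ and permutes the three coordinates (indexed by $C_3$) by inversion of the index. -/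

import Mathlib

namespace LDM

universe u v w

/-- A quasigroup: all left and right multiplication maps are bijective. -/
structure IsQuasigroup {Q : Type u} (op : Q → Q → Q) : Prop where
  left_bijective : ∀ a, Function.Bijective fun y => op a y
  right_bijective : ∀ b, Function.Bijective fun x => op x b

/-- Two binary operations are isostrophic (in the same main class) if there are `σ ∈ S₃` and
bijections `γ₁, γ₂, γ₃ : Q → R` such that
`x_{σ(1)} · x_{σ(2)} = x_{σ(3)} ↔ γ₁(x₁) ∘ γ₂(x₂) = γ₃(x₃)` for all `x₁, x₂, x₃`. -/
def Isostrophic {Q : Type u} {R : Type v} (op : Q → Q → Q) (op' : R → R → R) : Prop :=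
  ∃ (σ : Equiv.Perm (Fin 3)) (γ : Fin 3 → (Q ≃ R)), ∀ x : Fin 3 → Q,
    op (x (σ 0)) (x (σ 1)) = x (σ 2) ↔ op' (γ 0 (x 0)) (γ 1 (x 1)) = γ 2 (x 2)

/-- Subsquares `(S₁, S₂, S₃)`: `S₁ · S₂ ⊆ S₃`, `S₁ \ S₃ ⊆ S₂` and `S₃ / S₂ ⊆ S₁`. -/
structure IsSubsquare {Q : Type u} (op : Q → Q → Q) (S₁ S₂ S₃ : Set Q) : Prop where
  mul_mem : ∀ x ∈ S₁, ∀ y ∈ S₂, op x y ∈ S₃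
  left_div_mem : ∀ x ∈ S₁, ∀ y, op x y ∈ S₃ → y ∈ S₂
  right_div_mem : ∀ y ∈ S₂, ∀ x, op x y ∈ S₃ → x ∈ S₁

/-- `IsLabeling op α M` says that `(P, M)` is an abstract light dual multinet which is labeled by
the quasigroup `(Q, op)` through the maps `α 0`, `α 1`, `α 2`. The three components of the point
set `P` are the ranges of the injective maps `α i`. -/
structure IsLabeling {Q : Type u} {P : Type v} (op : Q → Q → Q) (α : Fin 3 → Q → P)
    (M : Set (Set P)) : Prop where
  quasigroup : IsQuasigroup op
  injective : ∀ i, Function.Injective (α i)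
  disjoint : ∀ i j, i ≠ j → Disjoint (Set.range (α i)) (Set.range (α j))
  cover : ⋃ i, Set.range (α i) = Set.univ
  /-- Two distinct points are on at most one block. -/
  block_unique : ∀ p q, p ≠ q → ∀ B ∈ M, ∀ C ∈ M, p ∈ B → q ∈ B → p ∈ C → q ∈ C → B = C
  collinear : ∀ x y, ∃ B ∈ M, α 0 x ∈ B ∧ α 1 y ∈ B ∧ α 2 (op x y) ∈ B
  /-- Every block meets at least two of the three components. -/
  meets_two : ∀ B ∈ M, ∃ i j, i ≠ j ∧ (∃ x, α i x ∈ B) ∧ ∃ y, α j y ∈ B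
  nontrivial : M.Nontrivial

/-- The set of labels of the points which the block `B` has in the `i`-th component. -/
def trace {Q : Type u} {P : Type v} (α : Fin 3 → Q → P) (B : Set P) (i : Fin 3) : Set Q :=
  {x | α i x ∈ B}

/-- The length of a block: the order of its subsquare `(trace α B 0, trace α B 1, trace α B 2)`,
see `isSubsquare_trace` and `ncard_trace_eq_length`. -/
noncomputable def length {Q : Type u} {P : Type v} (α : Fin 3 → Q → P) (B : Set P) : ℕ :=
  (trace α B 0).ncard

/-- A superline is a block of length greater than `1`. -/
def IsSuperline {Q : Type u} {P : Type v} (α : Fin 3 → Q → P) (M : Set (Set P))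
    (B : Set P) : Prop :=
  B ∈ M ∧ 1 < length α B

theorem isSubsquare_trace {Q : Type u} {P : Type v} {op : Q → Q → Q} {α : Fin 3 → Q → P}
    {M : Set (Set P)} (h : IsLabeling op α M) {B : Set P} (hB : B ∈ M) :
    IsSubsquare op (trace α B 0) (trace α B 1) (trace α B 2) := by
  have ne : ∀ i j : Fin 3, i ≠ j → ∀ x y, α i x ≠ α j y := fun i j hij x y e =>
    Set.disjoint_left.1 (h.disjoint i j hij) ⟨x, rfl⟩ ⟨y, e.symm⟩
  refine ⟨fun x hx y hy => ?_, fun x hx y hy => ?_, fun y hy x hx => ?_⟩ <;>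
    obtain ⟨C, hC, h0, h1, h2⟩ := h.collinear x y
  · have e := h.block_unique _ _ (ne 0 1 (by decide) x y) B hB C hC hx hy h0 h1
    subst e; exact h2
  · have e := h.block_unique _ _ (ne 0 2 (by decide) x (op x y)) B hB C hC hx hy h0 h2
    subst e; exact h1
  · have e := h.block_unique _ _ (ne 1 2 (by decide) y (op x y)) B hB C hC hy hx h1 h2
    subst e; exact h0

theorem ncard_trace_eq_length {Q : Type u} {P : Type v} [Finite Q] {op : Q → Q → Q}
    {α : Fin 3 → Q → P} {M : Set (Set P)} (h : IsLabeling op α M) {B : Set P} (hB : B ∈ M)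
    (i : Fin 3) : (trace α B i).Nonempty ∧ (trace α B i).ncard = length α B := by
  have S := isSubsquare_trace h hB
  have q := h.quasigroup
  have k01 : ∀ x ∈ trace α B 0, (trace α B 1).ncard = (trace α B 2).ncard := fun x hx =>
    Set.ncard_congr (fun y _ => op x y) (fun y hy => S.mul_mem x hx y hy)
      (fun a b _ _ e => (q.left_bijective x).1 e) fun z hz => by
        obtain ⟨y, rfl⟩ := (q.left_bijective x).2 z
        exact ⟨y, S.left_div_mem x hx y hz, rfl⟩
  have k02 : ∀ y ∈ trace α B 1, (trace α B 0).ncard = (trace α B 2).ncard := fun y hy =>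
    Set.ncard_congr (fun x _ => op x y) (fun x hx => S.mul_mem x hx y hy)
      (fun a b _ _ e => (q.right_bijective y).1 e) fun z hz => by
        obtain ⟨x, rfl⟩ := (q.right_bijective y).2 z
        exact ⟨x, S.right_div_mem y hy x hz, rfl⟩
  have n01 : ∃ x ∈ trace α B 0, ∃ y, y ∈ trace α B 1 := by
    have m02 : ∀ x ∈ trace α B 0, ∀ z ∈ trace α B 2, ∃ y, y ∈ trace α B 1 := fun x hx z hz => by
      obtain ⟨y, rfl⟩ := (q.left_bijective x).2 z
      exact ⟨y, S.left_div_mem x hx y hz⟩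
    have m12 : ∀ y ∈ trace α B 1, ∀ z ∈ trace α B 2, ∃ x, x ∈ trace α B 0 := fun y hy z hz => by
      obtain ⟨x, rfl⟩ := (q.right_bijective y).2 z
      exact ⟨x, S.right_div_mem y hy x hz⟩
    obtain ⟨i, j, hij, ⟨x, hx⟩, y, hy⟩ := h.meets_two B hB
    fin_cases i <;> fin_cases j
    · exact absurd rfl hij
    · exact ⟨x, hx, y, hy⟩
    · exact ⟨x, hx, m02 x hx y hy⟩
    · exact ⟨y, hy, x, hx⟩
    · exact absurd rfl hij
    · obtain ⟨a, ha⟩ := m12 x hx y hy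
      exact ⟨a, ha, x, hx⟩
    · exact ⟨y, hy, m02 y hy x hx⟩
    · obtain ⟨a, ha⟩ := m12 y hy x hx
      exact ⟨a, ha, y, hy⟩
    · exact absurd rfl hij
  obtain ⟨x, hx, y, hy⟩ := n01
  have e1 := k01 x hx
  have e2 := k02 y hy
  fin_cases i
  · exact ⟨⟨x, hx⟩, rfl⟩
  · exact ⟨⟨y, hy⟩, e1.trans e2.symm⟩
  · exact ⟨⟨_, S.mul_mem x hx y hy⟩, e2.symm⟩

/-- Simple incidence structures `(P, M)` and `(R, N)` are isomorphic if some bijection `P → R`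
of the points induces a bijection `M → N` of the blocks. -/
def Isomorphic {P : Type u} {R : Type v} (M : Set (Set P)) (N : Set (Set R)) : Prop :=
  ∃ e : P ≃ R, ∀ B : Set P, B ∈ M ↔ e '' B ∈ N

/-- The automorphism group of the simple incidence structure `(P, M)`. -/
def aut {P : Type u} (M : Set (Set P)) : Subgroup (Equiv.Perm P) where
  carrier := {e | ∀ B : Set P, B ∈ M ↔ e '' B ∈ M}
  one_mem' := fun B => by simp
  mul_mem' := fun {a b} ha hb B => by
    rw [hb B, ha (b '' B), ← Set.image_comp, Equiv.Perm.coe_mul]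
  inv_mem' := fun {a} ha B => by
    have h := ha ((a⁻¹ : Equiv.Perm P) '' B)
    rw [← Set.image_comp, ← Equiv.Perm.coe_mul, mul_inv_cancel, Equiv.Perm.coe_one,
      Set.image_id] at h
    exact h.symm

/-- Latin squares of the twelve main classes of quasigroups of order `6`: `denesKeedwell k` is
the representative of the class with Dénes–Keedwell number `6.(k+1)`, on the elements
`0, …, 5`. -/
def denesKeedwell (k : Fin 12) (x y : Fin 6) : Fin 6 :=
  (![
    ![![0, 1, 2, 3, 4, 5], ![1, 2, 3, 4, 5, 0], ![2, 3, 4, 5, 0, 1], ![3, 4, 5, 0, 1, 2], ![4, 5, 0, 1, 2, 3], ![5, 0, 1, 2, 3, 4]],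
    ![![0, 1, 2, 3, 4, 5], ![1, 0, 4, 5, 2, 3], ![2, 5, 0, 4, 3, 1], ![3, 4, 5, 0, 1, 2], ![4, 3, 1, 2, 5, 0], ![5, 2, 3, 1, 0, 4]],
    ![![0, 1, 2, 3, 4, 5], ![1, 2, 0, 4, 5, 3], ![2, 0, 1, 5, 3, 4], ![3, 5, 4, 1, 0, 2], ![4, 3, 5, 2, 1, 0], ![5, 4, 3, 0, 2, 1]],
    ![![0, 1, 2, 3, 4, 5], ![1, 0, 3, 2, 5, 4], ![2, 3, 4, 5, 0, 1], ![3, 2, 5, 4, 1, 0], ![4, 5, 0, 1, 3, 2], ![5, 4, 1, 0, 2, 3]],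
    ![![0, 1, 2, 3, 4, 5], ![1, 0, 4, 5, 2, 3], ![2, 5, 1, 4, 3, 0], ![3, 4, 5, 1, 0, 2], ![4, 3, 0, 2, 5, 1], ![5, 2, 3, 0, 1, 4]],
    ![![0, 1, 2, 3, 4, 5], ![1, 0, 3, 4, 5, 2], ![2, 5, 1, 0, 3, 4], ![3, 4, 5, 1, 2, 0], ![4, 2, 0, 5, 1, 3], ![5, 3, 4, 2, 0, 1]],
    ![![0, 1, 2, 3, 4, 5], ![1, 0, 3, 2, 5, 4], ![2, 4, 0, 5, 3, 1], ![3, 5, 4, 0, 1, 2], ![4, 2, 5, 1, 0, 3], ![5, 3, 1, 4, 2, 0]],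
    ![![0, 1, 2, 3, 4, 5], ![1, 0, 5, 4, 2, 3], ![2, 5, 0, 1, 3, 4], ![3, 4, 1, 0, 5, 2], ![4, 2, 3, 5, 0, 1], ![5, 3, 4, 2, 1, 0]],
    ![![0, 1, 2, 3, 4, 5], ![1, 2, 0, 5, 3, 4], ![2, 0, 1, 4, 5, 3], ![3, 5, 4, 0, 1, 2], ![4, 3, 5, 1, 2, 0], ![5, 4, 3, 2, 0, 1]],
    ![![0, 1, 2, 3, 4, 5], ![1, 0, 5, 4, 3, 2], ![2, 4, 0, 1, 5, 3], ![3, 5, 1, 0, 2, 4], ![4, 2, 3, 5, 1, 0], ![5, 3, 4, 2, 0, 1]],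
    ![![0, 1, 2, 3, 4, 5], ![1, 0, 3, 4, 5, 2], ![2, 3, 1, 5, 0, 4], ![3, 4, 5, 1, 2, 0], ![4, 5, 0, 2, 1, 3], ![5, 2, 4, 0, 3, 1]],
    ![![0, 1, 2, 3, 4, 5], ![1, 0, 4, 5, 3, 2], ![2, 4, 3, 1, 5, 0], ![3, 5, 1, 2, 0, 4], ![4, 3, 5, 0, 2, 1], ![5, 2, 0, 4, 1, 3]]] :
    Fin 12 → Fin 6 → Fin 6 → Fin 6) k x y

/-- The lengths of the superlines of the sixteen classes. -/
def superlineLength : Fin 16 → ℕ :=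
  ![3, 3, 2, 2, 2, 2, 2, 2, 2, 2, 2, 2, 2, 2, 2, 2]

/-- The Dénes–Keedwell numbers `6.d` of the labeling quasigroups of the sixteen classes, listed
by `d ∈ {1, …, 12}`. -/
def labelingNumbers : Fin 16 → Finset ℕ :=
  ![{1, 9}, {2, 3, 9}, {1, 4}, {2, 5}, {4}, {7}, {5}, {8, 11}, {10}, {11}, {9, 12}, {12},
    {6, 7}, {5, 10}, {7, 10}, {11, 12}]

/-- The cyclic group of order `n`, written multiplicatively. -/
abbrev C (n : ℕ) : Type := Multiplicative (ZMod n)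

/-- `(C₃ × C₃ × C₃) : C₃`, where `C₃` permutes the three coordinates cyclically. -/
abbrev C3Cubed_C3 : Type :=
  (C 3 → C 3) ⋊[(mulAutArrow : C 3 →* MulAut (C 3 → C 3))] C 3

/-- For signs `ε` and `δ`, the map `(f, k) ↦ (i ↦ f(i^δ)^ε, k^δ)` as an automorphism of
`(C₃ × C₃ × C₃) : C₃`. -/
def signAut (ε δ : ℤˣ) : MulAut C3Cubed_C3 where
  toFun g := ⟨fun i => g.left (i ^ (δ : ℤ)) ^ (ε : ℤ), g.right ^ (δ : ℤ)⟩
  invFun g := ⟨fun i => g.left (i ^ (δ : ℤ)) ^ (ε : ℤ), g.right ^ (δ : ℤ)⟩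
  left_inv g := by
    refine SemidirectProduct.ext (funext fun i => ?_) ?_
    · change (g.left ((i ^ (δ : ℤ)) ^ (δ : ℤ)) ^ (ε : ℤ)) ^ (ε : ℤ) = g.left i
      simp only [← zpow_mul, Int.units_coe_mul_self, zpow_one]
    · change (g.right ^ (δ : ℤ)) ^ (δ : ℤ) = g.right
      simp only [← zpow_mul, Int.units_coe_mul_self, zpow_one]
  right_inv g := by
    refine SemidirectProduct.ext (funext fun i => ?_) ?_
    · change (g.left ((i ^ (δ : ℤ)) ^ (δ : ℤ)) ^ (ε : ℤ)) ^ (ε : ℤ) = g.left i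
      simp only [← zpow_mul, Int.units_coe_mul_self, zpow_one]
    · change (g.right ^ (δ : ℤ)) ^ (δ : ℤ) = g.right
      simp only [← zpow_mul, Int.units_coe_mul_self, zpow_one]
  map_mul' g h := by
    refine SemidirectProduct.ext (funext fun i => ?_) ?_
    · change (g.left (i ^ (δ : ℤ)) * h.left (g.right⁻¹ * i ^ (δ : ℤ))) ^ (ε : ℤ) =
        g.left (i ^ (δ : ℤ)) ^ (ε : ℤ) *
          h.left (((g.right ^ (δ : ℤ))⁻¹ * i) ^ (δ : ℤ)) ^ (ε : ℤ)
      simp only [mul_zpow, inv_zpow, ← zpow_mul, Int.units_coe_mul_self, zpow_one]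
    · exact mul_zpow g.right h.right (δ : ℤ)

/-- The action of `C₂ × C₂` on `(C₃ × C₃ × C₃) : C₃`, where `C₂ = {1, -1}`: the first factor
inverts `C₃ × C₃ × C₃` and centralizes the top group `C₃`, the second one inverts the top group
and permutes the three coordinates accordingly. -/
def signHom : ℤˣ × ℤˣ →* MulAut C3Cubed_C3 where
  toFun s := signAut s.1 s.2
  map_one' := by
    refine MulEquiv.ext fun g => SemidirectProduct.ext (funext fun i => ?_) ?_
    · change g.left (i ^ ((1 : ℤˣ) : ℤ)) ^ ((1 : ℤˣ) : ℤ) = g.left i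
      simp only [Units.val_one, zpow_one]
    · change g.right ^ ((1 : ℤˣ) : ℤ) = g.right
      simp only [Units.val_one, zpow_one]
  map_mul' s t := by
    refine MulEquiv.ext fun g => SemidirectProduct.ext (funext fun i => ?_) ?_
    · change g.left (i ^ ((s.2 * t.2 : ℤˣ) : ℤ)) ^ ((s.1 * t.1 : ℤˣ) : ℤ) =
        (g.left ((i ^ (s.2 : ℤ)) ^ (t.2 : ℤ)) ^ (t.1 : ℤ)) ^ (s.1 : ℤ)
      rw [Units.val_mul, Units.val_mul, mul_comm (s.1 : ℤ), zpow_mul, zpow_mul]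
    · change g.right ^ ((s.2 * t.2 : ℤˣ) : ℤ) = (g.right ^ (t.2 : ℤ)) ^ (s.2 : ℤ)
      rw [Units.val_mul, mul_comm (s.2 : ℤ), zpow_mul]

/-- `((C₃ × C₃ × C₃) : C₃) : (C₂ × C₂)`, a group of order `324`. -/
abbrev C3Cubed_C3_C2C2 : Type := C3Cubed_C3 ⋊[signHom] (ℤˣ × ℤˣ)

end LDM

namespace LDM

universe u v w

/-! ### Latin relations, isostrophy and isomorphism -/

/-! Let `B₀` be the only superline. Every other block has one point in each component, so the
multinet consists of `B₀` and the lines of the triples `(x, y, x · y)` which do not lie in `B₀`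
(`IsLabeling.eq_netOf`). The traces of `B₀` form a proper subsquare, a "hole", whose order is at
most half of `6`; hence its length is `2` or `3`. An isotopy that normalizes a row and a column
through the hole turns the quasigroup into a loop on `{0, …, 5}` with identity `0` and subloop `{0,
…, m - 1}` (`IsLabeling.exists_isHoleyLoop`). There are finitely many such loops. An exhaustive
search (`latinSearch_two`, `latinSearch_three`) consumes a stored certificate for each of them and
checks that it describes a hole-preserving isostrophism to one of `27` tables. Such a map is at once
an isostrophism of quasigroups and an isomorphism of nets.

The net forgets the multiplication inside the hole. Tables which agree off the hole give the same
net, and so the `27` tables give `16` nets (`net_congr`). This is also why one multinet can be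
labeled by several main classes: refilling the hole may change the main class. If a quasigroup
labels `M i`, the classification gives a net `M j` isomorphic to `M i` whose list contains its main
class, and `j = i` because the nets are pairwise nonisomorphic; conversely, each listed class is
that of some table of the net.

An isomorphism of nets maps hole to hole, since the hole has `3m > 3` points, and it maps lines to
lines. Two points of a line determine the third, so an isomorphism is determined by its values on a
few generating points, and a depth-first search over these values meets all isomorphisms
(`exists_of_isoTest`). It finds none between different nets. For the automorphism groups, explicit
generators are matched with generators of the abstract group, whose elements have normal forms as
words. Comparing left multiplication by generators on both sides gives a homomorphism, and the
search shows that every automorphism is a word (`nonempty_aut_mulEquiv`). -/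

/-- The set of triples `(x, y, x · y)`. -/
def graph {Q : Type u} (op : Q → Q → Q) : Set (Fin 3 → Q) := {x | op (x 0) (x 1) = x 2}

theorem Isostrophic.symm {Q : Type u} {R : Type v} {op : Q → Q → Q} {op' : R → R → R}
    (h : Isostrophic op op') : Isostrophic op' op := by
  obtain ⟨σ, γ, h⟩ := h
  refine ⟨σ.symm, fun i => (γ (σ i)).symm, fun y => ?_⟩
  have := h fun i => (γ i).symm (y (σ.symm i))
  simpa using this.symm

theorem Isostrophic.trans {Q : Type u} {R : Type v} {S : Type w} {op : Q → Q → Q}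
    {op' : R → R → R} {op'' : S → S → S} (h : Isostrophic op op') (h' : Isostrophic op' op'') :
    Isostrophic op op'' := by
  obtain ⟨σ, γ, h⟩ := h
  obtain ⟨τ, δ, h'⟩ := h'
  refine ⟨τ * σ, fun i => (γ (τ.symm i)).trans (δ i), fun z => ?_⟩
  have h1 := h fun i => z (τ i)
  have h2 := h' fun i => γ (τ.symm i) (z i)
  simp only [Equiv.symm_apply_apply] at h2
  simpa [Equiv.trans_apply] using h1.trans h2

theorem Isomorphic.symm {P : Type u} {R : Type v} {M : Set (Set P)} {N : Set (Set R)}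
    (h : Isomorphic M N) : Isomorphic N M := by
  obtain ⟨e, h⟩ := h
  refine ⟨e.symm, fun B => ?_⟩
  rw [h, ← Set.image_comp]
  simp

theorem Isomorphic.trans {P : Type u} {R : Type v} {S : Type w} {M : Set (Set P)}
    {N : Set (Set R)} {K : Set (Set S)} (h : Isomorphic M N) (h' : Isomorphic N K) :
    Isomorphic M K := by
  obtain ⟨e, h⟩ := h
  obtain ⟨f, h'⟩ := h'
  refine ⟨e.trans f, fun B => ?_⟩
  rw [h, h', ← Set.image_comp]
  rfl

/-- A quasigroup labels every multinet which is labeled by an isostrophic quasigroup. -/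
theorem IsLabeling.of_isostrophic {Q : Type u} {R : Type v} {P : Type w} {op : Q → Q → Q}
    {op' : R → R → R} {α : Fin 3 → R → P} {M : Set (Set P)} (hq : IsQuasigroup op)
    (h : Isostrophic op op') (hα : IsLabeling op' α M) :
    ∃ β : Fin 3 → Q → P, IsLabeling op β M := by
  obtain ⟨σ, γ, h⟩ := h
  have hr : ∀ i, Set.range (fun q => α (σ i) (γ (σ i) q)) = Set.range (α (σ i)) := fun i =>
    (γ (σ i)).surjective.range_comp (α (σ i))
  refine ⟨fun i q => α (σ i) (γ (σ i) q), hq, fun i => (hα.injective _).comp (γ _).injective,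
    fun i j hij => ?_, ?_, hα.block_unique, fun x y => ?_, fun B hB => ?_, hα.nontrivial⟩
  · rw [hr, hr]
    exact hα.disjoint _ _ (σ.injective.ne hij)
  · rw [← hα.cover]
    simp only [hr]
    exact σ.surjective.iUnion_comp fun i => Set.range (α i)
  -- Isostrophy speaks of `x ∘ σ`, so the triple `u` of `op` enters it as `x = u ∘ σ⁻¹`.
  · let u : Fin 3 → Q := ![x, y, op x y]
    have hu : op' (γ 0 (u (σ.symm 0))) (γ 1 (u (σ.symm 1))) = γ 2 (u (σ.symm 2)) :=
      (h fun i => u (σ.symm i)).1 (by simp [u])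
    obtain ⟨B, hB, h0, h1, h2⟩ := hα.collinear (γ 0 (u (σ.symm 0))) (γ 1 (u (σ.symm 1)))
    rw [hu] at h2
    have hall : ∀ i, α i (γ i (u (σ.symm i))) ∈ B := by
      intro i; fin_cases i
      exacts [h0, h1, h2]
    have hall' : ∀ i, α (σ i) (γ (σ i) (u i)) ∈ B := fun i => by simpa using hall (σ i)
    exact ⟨B, hB, hall' 0, hall' 1, hall' 2⟩
  · obtain ⟨i, j, hij, ⟨x, hx⟩, y, hy⟩ := hα.meets_two B hB
    refine ⟨σ.symm i, σ.symm j, σ.symm.injective.ne hij, ⟨(γ i).symm x, ?_⟩, (γ j).symm y, ?_⟩ <;>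
      simpa

/-! ### The net of a Latin square with a subsquare -/

/-- The block `B₀` together with the lines `{α₁(x₁), α₂(x₂), α₃(x₃)}`, `x ∈ T`, which are not
contained in `B₀`. -/
def netOf {Q : Type u} {P : Type v} (α : Fin 3 → Q → P) (T : Set (Fin 3 → Q)) (B₀ : Set P) :
    Set (Set P) :=
  {B | B = B₀ ∨ ∃ x ∈ T, (∃ i, α i (x i) ∉ B₀) ∧ B = Set.range fun i => α i (x i)}

/-- The isomorphism sends the point with label `q` in component `i` to the point with label `γ (σ i)
q` in component `σ i`. `hT` makes lines correspond to lines and `hB` makes the distinguished blocks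
correspond. -/
theorem isomorphic_netOf {Q : Type*} {P : Type*} {Q' : Type*} {P' : Type*}
    {α : Fin 3 → Q → P} {α' : Fin 3 → Q' → P'}
    (hα : Function.Bijective fun p : Fin 3 × Q => α p.1 p.2)
    (hα' : Function.Bijective fun p : Fin 3 × Q' => α' p.1 p.2)
    {T : Set (Fin 3 → Q)} {T' : Set (Fin 3 → Q')} {B₀ : Set P} {B₀' : Set P'}
    (σ : Equiv.Perm (Fin 3)) (γ : Fin 3 → (Q ≃ Q'))
    (hT : ∀ x : Fin 3 → Q, (fun i => x (σ i)) ∈ T ↔ (fun i => γ i (x i)) ∈ T')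
    (hB : ∀ i q, α i q ∈ B₀ ↔ α' (σ i) (γ (σ i) q) ∈ B₀') :
    Isomorphic (netOf α T B₀) (netOf α' T' B₀') := by
  let e₁ : Fin 3 × Q ≃ Fin 3 × Q' :=
    { toFun := fun p => (σ p.1, γ (σ p.1) p.2)
      invFun := fun p => (σ.symm p.1, (γ p.1).symm p.2)
      left_inv := fun p => by simp
      right_inv := fun p => by simp }
  let e : P ≃ P' := (Equiv.ofBijective _ hα).symm.trans (e₁.trans (Equiv.ofBijective _ hα'))
  have he : ∀ i q, e (α i q) = α' (σ i) (γ (σ i) q) := fun i q => by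
    have : (Equiv.ofBijective _ hα).symm (α i q) = (i, q) :=
      (Equiv.ofBijective _ hα).symm_apply_eq.2 rfl
    simp only [e, Equiv.trans_apply, this]
    rfl
  have hsurj : ∀ p, ∃ i q, p = α i q := fun p => by
    obtain ⟨⟨i, q⟩, h⟩ := hα.2 p
    exact ⟨i, q, h.symm⟩
  have he₀ : ∀ p, p ∈ B₀ ↔ e p ∈ B₀' := fun p => by
    obtain ⟨i, q, rfl⟩ := hsurj p
    rw [he, hB]
  have hB₀ : e '' B₀ = B₀' := by
    ext p
    constructor
    · rintro ⟨q, hq, rfl⟩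
      exact (he₀ q).1 hq
    · intro hp
      exact ⟨e.symm p, (he₀ _).2 (by simpa), by simp⟩
  have hline : ∀ x : Fin 3 → Q, (e '' Set.range fun i => α i (x (σ i))) =
      Set.range fun i => α' i (γ i (x i)) := fun x => by
    rw [← Set.range_comp, ← σ.surjective.range_comp fun i => α' i (γ i (x i))]
    congr 1
    funext i
    exact he i _
  have hout : ∀ x : Fin 3 → Q, (∃ i, α i (x (σ i)) ∉ B₀) ↔ ∃ i, α' i (γ i (x i)) ∉ B₀' := by
    intro x
    simp only [hB]
    exact (σ.surjective.exists (p := fun i => α' i (γ i (x i)) ∉ B₀')).symm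
  refine ⟨e, fun B => ⟨?_, ?_⟩⟩
  · rintro (rfl | ⟨y, hy, hi, rfl⟩)
    · exact Or.inl hB₀
    · have e1 : y = fun i => y (σ.symm (σ i)) := by simp
      rw [e1] at hy hi
      right
      refine ⟨_, (hT fun i => y (σ.symm i)).1 hy, (hout fun i => y (σ.symm i)).1 hi, ?_⟩
      rw [← hline]
      simp
  · rintro (h | ⟨y, hy, hi, h⟩)
    · exact Or.inl (e.injective.image_injective (h.trans hB₀.symm))
    · have e1 : y = fun i => γ i ((γ i).symm (y i)) := by simp
      rw [e1] at hy hi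
      right
      refine ⟨_, (hT fun i => (γ i).symm (y i)).2 hy, (hout fun i => (γ i).symm (y i)).2 hi, ?_⟩
      apply e.injective.image_injective
      rw [h, hline fun i => (γ i).symm (y i)]
      simp

/-- If a hole-preserving map sends the triples of one quasigroup to triples of another one, then
the converse holds as well. -/
theorem graph_iff_of_forall {Q : Type u} {R : Type v} {op : Q → Q → Q} {op' : R → R → R}
    (hq : IsQuasigroup op') (σ : Equiv.Perm (Fin 3)) (γ : Fin 3 → (Q ≃ R))
    (h : ∀ u ∈ graph op, (fun i => γ i (u (σ.symm i))) ∈ graph op') (x : Fin 3 → Q) :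
    (fun i => x (σ i)) ∈ graph op ↔ (fun i => γ i (x i)) ∈ graph op' := by
  refine ⟨fun hx => by simpa using h _ hx, fun hx => ?_⟩
  -- `u` is the triple of `op` that agrees with `x ∘ σ` in the coordinates `0` and `1`. After
  -- transport, two triples of `op'` agree off the coordinate `σ 2`, hence everywhere.
  let u : Fin 3 → Q := ![x (σ 0), x (σ 1), op (x (σ 0)) (x (σ 1))]
  have hu := h u rfl
  -- `γ x` and `γ (u ∘ σ.symm)` are triples of `op'` which agree off one coordinate.
  have key : ∀ (k : Fin 3) (a b : Fin 3 → R), a ∈ graph op' → b ∈ graph op' →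
      (∀ i, i ≠ k → a i = b i) → a k = b k := by
    intro k a b ha hb hab
    have ha' : op' (a 0) (a 1) = a 2 := ha
    have hb' : op' (b 0) (b 1) = b 2 := hb
    fin_cases k
    · have h1 := hab 1 (by decide)
      have h2 := hab 2 (by decide)
      refine (hq.right_bijective (b 1)).1 ?_
      change op' (a 0) (b 1) = op' (b 0) (b 1)
      rw [hb', ← h2, ← h1, ha']
    · have h0 := hab 0 (by decide)
      have h2 := hab 2 (by decide)
      refine (hq.left_bijective (b 0)).1 ?_
      change op' (b 0) (a 1) = op' (b 0) (b 1)
      rw [hb', ← h2, ← h0, ha']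
    · have h0 := hab 0 (by decide)
      have h1 := hab 1 (by decide)
      change a 2 = b 2
      rw [← ha', ← hb', h0, h1]
  have hne : ∀ i, i ≠ σ 2 → u (σ.symm i) = x i := by
    intro i hi
    obtain ⟨j, rfl⟩ := σ.surjective i
    rw [Equiv.symm_apply_apply]
    fin_cases j
    · rfl
    · rfl
    · exact absurd rfl hi
  have := key (σ 2) _ _ hu hx fun i hi => by simp only [hne i hi]
  have := (γ (σ 2)).injective this
  rw [Equiv.symm_apply_apply] at this
  exact this

/-! ### Blocks of light dual multinets -/

section Labeling

variable {Q : Type u} {P : Type v} {op : Q → Q → Q} {α : Fin 3 → Q → P} {M : Set (Set P)}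

theorem IsLabeling.eq_of_eq (h : IsLabeling op α M) {i j : Fin 3} {x y : Q}
    (e : α i x = α j y) : i = j ∧ x = y := by
  have hij : i = j := by
    by_contra hij
    exact Set.disjoint_left.1 (h.disjoint i j hij) ⟨x, rfl⟩ ⟨y, e.symm⟩
  subst hij
  exact ⟨rfl, h.injective i e⟩

theorem IsLabeling.bijective (h : IsLabeling op α M) :
    Function.Bijective fun p : Fin 3 × Q => α p.1 p.2 := by
  refine ⟨fun p q e => Prod.ext (h.eq_of_eq e).1 (h.eq_of_eq e).2, fun p => ?_⟩
  have hp : p ∈ ⋃ i, Set.range (α i) := h.cover ▸ Set.mem_univ p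
  obtain ⟨i, x, rfl⟩ := Set.mem_iUnion.1 hp
  exact ⟨(i, x), rfl⟩

theorem IsLabeling.eq_image (h : IsLabeling op α M) (B : Set P) :
    B = ⋃ i, α i '' trace α B i := by
  ext p
  obtain ⟨⟨i, x⟩, rfl⟩ := h.bijective.2 p
  simp only [Set.mem_iUnion, Set.mem_image]
  constructor
  · exact fun hp => ⟨i, x, hp, rfl⟩
  · rintro ⟨j, y, hy, e⟩
    exact e ▸ hy

/-- The three traces have the same size. Consequently the length depends only on the block as a
point set, not on the labeling. -/
theorem IsLabeling.ncard_eq [Finite Q] (h : IsLabeling op α M) {B : Set P} (hB : B ∈ M) :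
    B.ncard = 3 * length α B := by
  have hc : ∀ i, (α i '' trace α B i).ncard = length α B := fun i => by
    rw [Set.ncard_image_of_injective _ (h.injective i), (ncard_trace_eq_length h hB i).2]
  have hd : ∀ i j, i ≠ j → Disjoint (α i '' trace α B i) (α j '' trace α B j) := fun i j hij =>
    (h.disjoint i j hij).mono (Set.image_subset_range _ _) (Set.image_subset_range _ _)
  have e : B = (α 0 '' trace α B 0 ∪ α 1 '' trace α B 1) ∪ α 2 '' trace α B 2 := by
    conv_lhs => rw [h.eq_image B]
    ext p
    simp only [Set.mem_iUnion, Fin.exists_fin_succ, Set.mem_union]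
    simp [or_assoc]
  have hn := congrArg Set.ncard e
  rw [Set.ncard_union_eq, Set.ncard_union_eq, hc, hc, hc] at hn
  · lia
  · exact hd 0 1 (by decide)
  · exact Set.disjoint_union_left.2 ⟨hd 0 2 (by decide), hd 1 2 (by decide)⟩

theorem IsLabeling.one_le_length [Finite Q] (h : IsLabeling op α M) {B : Set P} (hB : B ∈ M) :
    1 ≤ length α B := by
  obtain ⟨h0, e⟩ := ncard_trace_eq_length h hB 0
  rw [← e]
  exact (Set.ncard_pos (Set.toFinite _)).2 h0

/-- Every block is determined by two of its points. -/
theorem IsLabeling.eq_of_subset (h : IsLabeling op α M) [Finite Q] {B C : Set P} (hB : B ∈ M)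
    (hC : C ∈ M) (hBC : B ⊆ C) : B = C := by
  obtain ⟨⟨x, hx⟩, -⟩ := ncard_trace_eq_length h hB 0
  obtain ⟨⟨y, hy⟩, -⟩ := ncard_trace_eq_length h hB 1
  refine h.block_unique (α 0 x) (α 1 y) (fun e => ?_) B hB C hC hx hy (hBC hx) (hBC hy)
  exact absurd (h.eq_of_eq e).1 (by decide)

/-- For `x` outside the first trace and `y` in the second, `x · y` avoids the third trace, as
division would otherwise put `x` into the first. So left multiplication by `x` embeds the second
trace into the complement of the third. Such an `x` exists: a block with full first trace contains
all points, hence all blocks, against `nontrivial`. -/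
theorem IsLabeling.length_mul_two_le [Finite Q] (h : IsLabeling op α M) {B : Set P}
    (hB : B ∈ M) : 2 * length α B ≤ Nat.card Q := by
  have hS := isSubsquare_trace h hB
  have hne : trace α B 0 ≠ Set.univ := by
    intro h0
    have hl : length α B = Nat.card Q := by
      rw [length, h0, Set.ncard_univ]
    have hall : ∀ i, trace α B i = Set.univ := fun i => by
      apply Set.eq_of_subset_of_ncard_le (Set.subset_univ _)
      rw [Set.ncard_univ, (ncard_trace_eq_length h hB i).2, hl]
    have huniv : B = Set.univ := by
      rw [h.eq_image B, ← h.cover]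
      simp [hall]
    obtain ⟨C, hC, D, hD, hCD⟩ := h.nontrivial
    apply hCD
    rw [h.eq_of_subset hC hB (huniv ▸ Set.subset_univ _),
      h.eq_of_subset hD hB (huniv ▸ Set.subset_univ _)]
  obtain ⟨x, hx⟩ := (Set.ne_univ_iff_exists_notMem _).1 hne
  have hle : (trace α B 1).ncard ≤ ((trace α B 2)ᶜ).ncard := by
    refine Set.ncard_le_ncard_of_injOn (fun y => op x y) (fun y hy hxy => hx ?_)
      (h.quasigroup.left_bijective x).1.injOn
    exact hS.right_div_mem y hy x hxy
  have hcompl := Set.ncard_add_ncard_compl (trace α B 2)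
  rw [(ncard_trace_eq_length h hB 1).2] at hle
  rw [(ncard_trace_eq_length h hB 2).2] at hcompl
  lia

/-- A block of length `1` is a line. -/
theorem IsLabeling.eq_range_of_length_eq_one [Finite Q] (h : IsLabeling op α M) {B : Set P}
    (hB : B ∈ M) (hl : length α B = 1) :
    ∃ x ∈ graph op, B = Set.range fun i => α i (x i) := by
  have hs : ∀ i, ∃ a, trace α B i = {a} := fun i =>
    Set.ncard_eq_one.1 ((ncard_trace_eq_length h hB i).2.trans hl)
  choose x hx using hs
  refine ⟨x, ?_, ?_⟩
  · have := (isSubsquare_trace h hB).mul_mem (x 0) (by simp [hx]) (x 1) (by simp [hx])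
    rw [hx] at this
    exact this
  · conv_lhs => rw [h.eq_image B]
    ext p
    simp [hx, eq_comm]

theorem IsLabeling.exists_block (h : IsLabeling op α M) {x : Fin 3 → Q} (hx : x ∈ graph op) :
    ∃ B ∈ M, ∀ i, α i (x i) ∈ B := by
  obtain ⟨B, hB, h0, h1, h2⟩ := h.collinear (x 0) (x 1)
  have hx' : op (x 0) (x 1) = x 2 := hx
  rw [hx'] at h2
  refine ⟨B, hB, fun i => ?_⟩
  fin_cases i
  exacts [h0, h1, h2]

/-- A block other than `B₀` has length `1`, hence is the line of a triple. Conversely, the block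
through a triple not inside `B₀` differs from `B₀`, so it is a line, and the line of that very
triple. -/
theorem IsLabeling.eq_netOf [Finite Q] (h : IsLabeling op α M) {B₀ : Set P}
    (hB₀ : IsSuperline α M B₀) (huniq : ∀ B, IsSuperline α M B → B = B₀) :
    M = netOf α (graph op) B₀ := by
  have hline : ∀ B ∈ M, B ≠ B₀ → ∃ x ∈ graph op, B = Set.range fun i => α i (x i) := by
    intro B hB hne
    refine h.eq_range_of_length_eq_one hB ?_
    have h1 := h.one_le_length hB
    have h2 : ¬ 1 < length α B := fun hlt => hne (huniq B ⟨hB, hlt⟩)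
    lia
  ext B
  constructor
  · intro hB
    by_cases hne : B = B₀
    · exact Or.inl hne
    · obtain ⟨x, hx, rfl⟩ := hline B hB hne
      refine Or.inr ⟨x, hx, ?_, rfl⟩
      by_contra hall
      push Not at hall
      refine hne (h.eq_of_subset hB hB₀.1 ?_)
      rintro _ ⟨i, rfl⟩
      exact hall i
  · rintro (rfl | ⟨x, hx, ⟨i, hi⟩, rfl⟩)
    · exact hB₀.1
    · obtain ⟨B, hB, hxB⟩ := h.exists_block hx
      have hne : B ≠ B₀ := by
        rintro rfl
        exact hi (hxB i)
      obtain ⟨y, -, rfl⟩ := hline B hB hne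
      have hxy : x = y := by
        funext j
        obtain ⟨k, hk⟩ := hxB j
        obtain ⟨rfl, e⟩ := h.eq_of_eq hk
        exact e.symm
      exact hxy ▸ hB

end Labeling

/-! ### Nets on eighteen points -/

/-- The point with label `v` in the component `i`. -/
def pt (i : Fin 3) (v : Fin 6) : Fin 18 := finProdFinEquiv (i, v)

theorem pt_bijective : Function.Bijective fun p : Fin 3 × Fin 6 => pt p.1 p.2 :=
  finProdFinEquiv.bijective

theorem pt_val (i : Fin 3) (v : Fin 6) : (pt i v : ℕ) = 6 * i + v := by
  simp [pt, finProdFinEquiv]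
  lia

theorem pt_inj {i j : Fin 3} {v w : Fin 6} : pt i v = pt j w ↔ i = j ∧ v = w := by
  constructor
  · intro h
    have := pt_bijective.1 (a₁ := (i, v)) (a₂ := (j, w)) h
    simpa using this
  · rintro ⟨rfl, rfl⟩
    rfl

theorem exists_pt (p : Fin 18) : ∃ i v, p = pt i v := by
  obtain ⟨⟨i, v⟩, h⟩ := pt_bijective.2 p
  exact ⟨i, v, h.symm⟩

/-- The points whose labels are smaller than `m`. -/
def hole (m : ℕ) : Set (Fin 18) := {p | (p : ℕ) % 6 < m}

theorem pt_mem_hole {m : ℕ} {i : Fin 3} {v : Fin 6} : pt i v ∈ hole m ↔ (v : ℕ) < m := by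
  have : (pt i v : ℕ) % 6 = v := by
    rw [pt_val]
    have := v.isLt
    lia
  simp [hole, this]

/-- The net of an operation on `{0, …, 5}` for which `{0, …, m - 1}` is closed. -/
def net (m : ℕ) (op : Fin 6 → Fin 6 → Fin 6) : Set (Set (Fin 18)) :=
  netOf pt (graph op) (hole m)

/-- A quasigroup on `{0, …, 5}` with the subquasigroup `{0, …, m - 1}`. -/
structure IsHoley (m : ℕ) (op : Fin 6 → Fin 6 → Fin 6) : Prop where
  quasigroup : IsQuasigroup op
  closed : ∀ x y : Fin 6, (x : ℕ) < m → ((op x y : ℕ) < m ↔ (y : ℕ) < m)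

theorem ncard_hole {m : ℕ} (hm : m ≤ 6) : (hole m).ncard = 3 * m := by
  have : hole m = ((Finset.univ.filter fun p : Fin 18 => (p : ℕ) % 6 < m : Finset (Fin 18)) :
      Set (Fin 18)) := by
    ext p
    simp [hole]
  rw [this, Set.ncard_coe_finset]
  interval_cases m <;> decide

theorem ncard_line (x : Fin 3 → Fin 6) : (Set.range fun i => pt i (x i)).ncard = 3 := by
  rw [← Set.image_univ, Set.ncard_image_of_injective, Set.ncard_univ, Nat.card_eq_fintype_card,
    Fintype.card_fin]
  intro i j h
  exact (pt_inj.1 h).1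

theorem pt_mem_line {x : Fin 3 → Fin 6} {i : Fin 3} {v : Fin 6} :
    pt i v ∈ (Set.range fun i => pt i (x i)) ↔ v = x i := by
  constructor
  · rintro ⟨j, hj⟩
    obtain ⟨rfl, e⟩ := pt_inj.1 hj
    exact e.symm
  · rintro rfl
    exact ⟨i, rfl⟩

/-- Right translation by `y` maps the finite set `{0, …, m - 1}` injectively into itself, hence onto
itself, so no other element can be sent there. -/
theorem IsHoley.closed_right {m : ℕ} {op : Fin 6 → Fin 6 → Fin 6} (h : IsHoley m op)
    (x y : Fin 6) (hy : (y : ℕ) < m) : ((op x y : ℕ) < m ↔ (x : ℕ) < m) := by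
  refine ⟨fun hxy => ?_, fun hx => (h.closed x y hx).2 hy⟩
  let S : Set (Fin 6) := {v | (v : ℕ) < m}
  have hinj := (h.quasigroup.right_bijective y).1
  have hsub : (fun x => op x y) '' S ⊆ S := by
    rintro _ ⟨z, hz, rfl⟩
    exact (h.closed z y hz).2 hy
  have heq := Set.eq_of_subset_of_ncard_le hsub (Set.ncard_image_of_injective S hinj).ge
  have hmem : op x y ∈ (fun x => op x y) '' S := (Set.ext_iff.1 heq _).2 hxy
  obtain ⟨z, hz, e⟩ := hmem
  exact hinj e ▸ hz

theorem graph_eq_of_eq {Q : Type u} {op : Q → Q → Q} (hq : IsQuasigroup op) {x y : Fin 3 → Q}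
    (hx : x ∈ graph op) (hy : y ∈ graph op) {i j : Fin 3} (hij : i ≠ j) (hi : x i = y i)
    (hj : x j = y j) : x = y := by
  have hx' : op (x 0) (x 1) = x 2 := hx
  have hy' : op (y 0) (y 1) = y 2 := hy
  have h01 : x 0 = y 0 → x 1 = y 1 → x = y := fun h0 h1 => by
    funext k
    fin_cases k
    · exact h0
    · exact h1
    · change x 2 = y 2
      rw [← hx', ← hy', h0, h1]
  have h02 : x 0 = y 0 → x 2 = y 2 → x = y := fun h0 h2 =>
    h01 h0 ((hq.left_bijective (x 0)).1 (by
      change op (x 0) (x 1) = op (x 0) (y 1)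
      rw [hx', h2, h0, hy']))
  have h12 : x 1 = y 1 → x 2 = y 2 → x = y := fun h1 h2 =>
    h01 ((hq.right_bijective (x 1)).1 (by
      change op (x 0) (x 1) = op (y 0) (x 1)
      rw [hx', h2, h1, hy'])) h1
  fin_cases i <;> fin_cases j
  · exact absurd rfl hij
  · exact h01 hi hj
  · exact h02 hi hj
  · exact h01 hj hi
  · exact absurd rfl hij
  · exact h12 hi hj
  · exact h02 hj hi
  · exact h12 hj hi
  · exact absurd rfl hij

theorem IsHoley.mem_hole_of_two {m : ℕ} {op : Fin 6 → Fin 6 → Fin 6} (h : IsHoley m op)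
    {x : Fin 3 → Fin 6} (hx : x ∈ graph op) {i j : Fin 3} (hij : i ≠ j)
    (hi : (x i : ℕ) < m) (hj : (x j : ℕ) < m) (k : Fin 3) : (x k : ℕ) < m := by
  have hx' : op (x 0) (x 1) = x 2 := hx
  have h0 := h.closed (x 0) (x 1)
  have h1 := h.closed_right (x 0) (x 1)
  rw [hx'] at h0 h1
  fin_cases i <;> fin_cases j <;> fin_cases k <;> simp_all

theorem IsHoley.isLabeling {m : ℕ} (hm : 2 ≤ m) (hm' : m ≤ 3) {op : Fin 6 → Fin 6 → Fin 6}
    (h : IsHoley m op) : IsLabeling op pt (net m op) := by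
  have hhole : hole m ∈ net m op := Or.inl rfl
  have hgr : ∀ x y, ![x, y, op x y] ∈ graph op := fun x y => rfl
  refine ⟨h.quasigroup, fun i x y e => (pt_inj.1 e).2, fun i j hij => ?_, ?_, ?_, fun x y => ?_,
    ?_, ?_⟩
  · rw [Set.disjoint_left]
    rintro _ ⟨x, rfl⟩ ⟨y, e⟩
    exact hij (pt_inj.1 e).1.symm
  · refine Set.eq_univ_of_forall fun p => ?_
    obtain ⟨i, v, rfl⟩ := exists_pt p
    exact Set.mem_iUnion.2 ⟨i, v, rfl⟩
  · -- a line and the hole share at most one point, and so do two lines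
    have key : ∀ p q, p ≠ q → ∀ x ∈ graph op, (∃ i, pt i (x i) ∉ hole m) →
        p ∈ (Set.range fun i => pt i (x i)) → q ∈ (Set.range fun i => pt i (x i)) →
        p ∈ hole m → q ∈ hole m → False := by
      rintro _ _ hpq x hx ⟨k, hk⟩ ⟨i, rfl⟩ ⟨j, rfl⟩ hp hq
      have hij : i ≠ j := by
        rintro rfl
        exact hpq rfl
      exact hk (pt_mem_hole.2
        (h.mem_hole_of_two hx hij (pt_mem_hole.1 hp) (pt_mem_hole.1 hq) k))
    rintro p q hpq B (rfl | ⟨x, hx, hxo, rfl⟩) C (rfl | ⟨y, hy, hyo, rfl⟩) hpB hqB hpC hqC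
    · rfl
    · exact (key p q hpq y hy hyo hpC hqC hpB hqB).elim
    · exact (key p q hpq x hx hxo hpB hqB hpC hqC).elim
    · obtain ⟨i, rfl⟩ := hpB
      obtain ⟨j, rfl⟩ := hqB
      have hij : i ≠ j := by
        rintro rfl
        exact hpq rfl
      rw [graph_eq_of_eq h.quasigroup hx hy hij (pt_mem_line.1 hpC) (pt_mem_line.1 hqC)]
  · by_cases hout : ∃ i, pt i (![x, y, op x y] i) ∉ hole m
    · exact ⟨_, Or.inr ⟨_, hgr x y, hout, rfl⟩, ⟨0, rfl⟩, ⟨1, rfl⟩, ⟨2, rfl⟩⟩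
    · push Not at hout
      exact ⟨_, hhole, hout 0, hout 1, hout 2⟩
  · rintro B (rfl | ⟨x, -, -, rfl⟩)
    · exact ⟨0, 1, by decide, ⟨0, pt_mem_hole.2 (by simp; lia)⟩, 0,
        pt_mem_hole.2 (by simp; lia)⟩
    · exact ⟨0, 1, by decide, ⟨x 0, 0, rfl⟩, x 1, 1, rfl⟩
  -- The label `5` is outside the hole because `m ≤ 3`. The resulting line has `3` points and the
  -- hole has `3m ≥ 6`, so these are two different blocks.
  · have hout : ∃ i, pt i (![(0 : Fin 6), 5, op 0 5] i) ∉ hole m := ⟨1, fun hc => by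
      have := pt_mem_hole.1 hc
      simp at this
      lia⟩
    refine ⟨_, hhole, _, Or.inr ⟨_, hgr 0 5, hout, rfl⟩, fun e => ?_⟩
    have := congrArg Set.ncard e
    rw [ncard_hole (by lia), ncard_line] at this
    lia

/-- Under any labeling a block has three times as many points as its length; lines have `3` points
and the hole has `3m > 3`. -/
theorem isSuperline_net_iff {Q : Type u} [Finite Q] {m : ℕ} (hm : 2 ≤ m) (hm' : m ≤ 3)
    {op : Fin 6 → Fin 6 → Fin 6} {op' : Q → Q → Q} {α : Fin 3 → Q → Fin 18}
    (h : IsLabeling op' α (net m op)) {B : Set (Fin 18)} :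
    IsSuperline α (net m op) B ↔ B = hole m := by
  constructor
  · rintro ⟨hB, hl⟩
    have hc := h.ncard_eq hB
    obtain rfl | ⟨x, -, -, rfl⟩ := hB
    · rfl
    · rw [ncard_line] at hc
      lia
  · rintro rfl
    have hB : hole m ∈ net m op := Or.inl rfl
    have hc := h.ncard_eq hB
    rw [ncard_hole (by lia)] at hc
    exact ⟨hB, by lia⟩

theorem length_hole {Q : Type u} [Finite Q] {m : ℕ} (hm' : m ≤ 6)
    {op : Fin 6 → Fin 6 → Fin 6} {op' : Q → Q → Q} {α : Fin 3 → Q → Fin 18}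
    (h : IsLabeling op' α (net m op)) : length α (hole m) = m := by
  have hc := h.ncard_eq (B := hole m) (Or.inl rfl)
  rw [ncard_hole hm'] at hc
  lia

theorem IsLabeling.finite_of_fin {Q : Type u} {n : ℕ} {op : Q → Q → Q} {α : Fin 3 → Q → Fin n}
    {M : Set (Set (Fin n))} (h : IsLabeling op α M) : Finite Q :=
  Finite.of_injective _ (h.injective 0)

theorem IsLabeling.card_eq_six {Q : Type u} {op : Q → Q → Q} {α : Fin 3 → Q → Fin 18}
    {M : Set (Set (Fin 18))} (h : IsLabeling op α M) : Nat.card Q = 6 := by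
  have := Nat.card_congr (Equiv.ofBijective _ h.bijective)
  rw [Nat.card_prod] at this
  simp at this
  lia

/-! ### Loops with a hole -/

theorem exists_equiv_fin {Q : Type u} {n m : ℕ} [NeZero n] (hQ : Nat.card Q = n) {S : Set Q}
    (hS : S.ncard = m) (hm : 0 < m) {c : Q} (hc : c ∈ S) :
    ∃ e : Q ≃ Fin n, e c = 0 ∧ ∀ q, q ∈ S ↔ (e q : ℕ) < m := by
  have : Finite Q := Nat.finite_of_card_ne_zero (hQ ▸ NeZero.ne n)
  obtain ⟨e₀⟩ : Nonempty (Q ≃ Fin n) := ⟨Finite.equivFinOfCardEq hQ⟩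
  have hmn : m ≤ n := by
    rw [← hS, ← hQ]
    exact Set.ncard_le_card S
  have hcard : Nat.card {v : Fin n // e₀.symm v ∈ S} = Nat.card {v : Fin n // (v : ℕ) < m} := by
    rw [Nat.card_congr (e₀.symm.subtypeEquiv (q := fun q => q ∈ S) fun v => Iff.rfl)]
    rw [Nat.card_eq_fintype_card (α := {v : Fin n // (v : ℕ) < m}), Fintype.card_subtype]
    rw [Fin.card_filter_val_lt, min_eq_right hmn]
    exact hS
  classical
  obtain ⟨f⟩ : Nonempty ({v : Fin n // e₀.symm v ∈ S} ≃ {v : Fin n // (v : ℕ) < m}) :=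
    Finite.card_eq.1 hcard
  let g : Q ≃ Fin n := e₀.trans f.extendSubtype
  have hg : ∀ q, q ∈ S ↔ (g q : ℕ) < m := fun q => by
    constructor
    · intro hq
      exact f.extendSubtype_mem (e₀ q) (by simpa)
    · intro hq
      by_contra hqS
      exact f.extendSubtype_not_mem (e₀ q) (by simpa) hq
  -- Both swapped values `g c` and `0` are below `m`, so the swap does not disturb the image of `S`.
  refine ⟨g.trans (Equiv.swap (g c) 0), by simp, fun q => ?_⟩
  have hgc := (hg c).1 hc
  rw [hg, Equiv.trans_apply (f := g), Equiv.swap_apply_def]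
  split_ifs with h1 h2
  · simp [h1, hgc, hm]
  · simp [h2, hgc, hm]
  · rfl

/-- A loop on `{0, …, 5}` with identity `0` and with the subloop `{0, …, m - 1}`. -/
structure IsHoleyLoop (m : ℕ) (op : Fin 6 → Fin 6 → Fin 6) : Prop extends IsHoley m op where
  zero_left : ∀ y, op 0 y = y
  zero_right : ∀ x, op x 0 = x

/-- This is the passage to a principal loop isotope, with the row `r` and the column `c` chosen
inside the superline. Then the three renamings carry the traces of the superline to the same set
`{0, …, m - 1}`. The bounds `1 < m` and `2m ≤ 6` leave `m = 2` and `m = 3`. -/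
theorem IsLabeling.exists_isHoleyLoop {Q : Type u} {P : Type v} {op : Q → Q → Q}
    {α : Fin 3 → Q → P} {N : Set (Set P)} (hQ : Nat.card Q = 6) (h : IsLabeling op α N)
    (hu : ∃! B, IsSuperline α N B) :
    ∃ m, (m = 2 ∨ m = 3) ∧ ∃ op', IsHoleyLoop m op' ∧ Isostrophic op op' ∧
      Isomorphic N (net m op') := by
  have : Finite Q := Nat.finite_of_card_ne_zero (by lia)
  obtain ⟨B, hB, huniq⟩ := hu
  have hN := h.eq_netOf hB huniq
  have hS := isSubsquare_trace h hB.1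
  have hq := h.quasigroup
  have hle := h.length_mul_two_le hB.1
  have hlt := hB.2
  obtain ⟨⟨r, hr⟩, -⟩ := ncard_trace_eq_length h hB.1 0
  obtain ⟨⟨c, hc⟩, hl⟩ := ncard_trace_eq_length h hB.1 1
  generalize length α B = m at *
  obtain ⟨γ₁, h0, h1⟩ := exists_equiv_fin hQ hl (by lia) hc
  let L : Q ≃ Q := Equiv.ofBijective _ (hq.left_bijective r)
  let R : Q ≃ Q := Equiv.ofBijective _ (hq.right_bijective c)
  have hL : ∀ y, L y = op r y := fun y => rfl
  have hR : ∀ x, R x = op x c := fun x => rfl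
  -- The symbols are renamed so that the row of `r` becomes the identity, then the rows so that the
  -- column of `c` does: `γ₂ (r · y) = γ₁ y` and `γ₀ x = γ₂ (x · c)`.
  let γ₂ : Q ≃ Fin 6 := L.symm.trans γ₁
  let γ₀ : Q ≃ Fin 6 := R.trans γ₂
  have hγ₂ : ∀ y, γ₂ (op r y) = γ₁ y := fun y => by
    rw [← hL]
    simp [γ₂]
  have hγ₀ : ∀ x, γ₀ x = γ₂ (op x c) := fun x => rfl
  have h2 : ∀ q, q ∈ trace α B 2 ↔ (γ₂ q : ℕ) < m := fun q => by
    obtain ⟨y, rfl⟩ := (hq.left_bijective r).2 q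
    rw [hγ₂, ← h1]
    exact ⟨hS.left_div_mem r hr y, hS.mul_mem r hr y⟩
  have h0' : ∀ q, q ∈ trace α B 0 ↔ (γ₀ q : ℕ) < m := fun q => by
    rw [hγ₀, ← h2]
    exact ⟨fun hq => hS.mul_mem q hq c hc, hS.right_div_mem c hc q⟩
  let op' : Fin 6 → Fin 6 → Fin 6 := fun x y => γ₂ (op (γ₀.symm x) (γ₁.symm y))
  have hc' : γ₁.symm 0 = c := γ₁.symm_apply_eq.2 h0.symm
  have hr' : γ₀.symm 0 = r := γ₀.symm_apply_eq.2 (by rw [hγ₀, hγ₂, h0])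
  let γ : Fin 3 → (Q ≃ Fin 6) := ![γ₀, γ₁, γ₂]
  have hgraph : ∀ x : Fin 3 → Q, (fun i => x ((1 : Equiv.Perm (Fin 3)) i)) ∈ graph op ↔
      (fun i => γ i (x i)) ∈ graph op' := by
    intro x
    change op (x 0) (x 1) = x 2 ↔ γ₂ (op (γ₀.symm (γ₀ (x 0))) (γ₁.symm (γ₁ (x 1)))) = γ₂ (x 2)
    simp
  have hcl : ∀ x y : Fin 6, (x : ℕ) < m → ((op' x y : ℕ) < m ↔ (y : ℕ) < m) := fun x y hx => by
    have hx' : γ₀.symm x ∈ trace α B 0 := (h0' _).2 (by simpa)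
    rw [← h2]
    conv_rhs => rw [← γ₁.apply_symm_apply y, ← h1]
    exact ⟨hS.left_div_mem _ hx' _, hS.mul_mem _ hx' _⟩
  refine ⟨m, by lia, op', ⟨⟨⟨fun a => ?_, fun b => ?_⟩, hcl⟩, fun y => ?_, fun x => ?_⟩, ?_, ?_⟩
  · exact γ₂.bijective.comp ((hq.left_bijective _).comp γ₁.symm.bijective)
  · exact γ₂.bijective.comp ((hq.right_bijective _).comp γ₀.symm.bijective)
  · simp [op', hr', hγ₂]
  · simp [op', hc', ← hγ₀]
  · exact ⟨1, γ, hgraph⟩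
  · rw [hN]
    refine isomorphic_netOf h.bijective pt_bijective 1 γ hgraph fun i q => ?_
    rw [pt_mem_hole]
    fin_cases i
    exacts [h0' q, h1 q, h2 q]

/-! ### Packed Latin squares -/

/-- `force n k` is `k n`, but `n` is evaluated before `k` is applied to it. -/
noncomputable def force {α : Type u} (n : ℕ) (k : ℕ → α) : α := Nat.rec (k 0) (fun v _ => k (Nat.succ v)) n

theorem force_eq {α : Type u} (n : ℕ) (k : ℕ → α) : force n k = k n := by
  cases n <;> rfl

/-- The `i`-th of the `k + 1` octal digits of `n`. -/
def oct (k n i : ℕ) : ℕ := Nat.mod (Nat.div n (Nat.pow 8 (Nat.sub k i))) 8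

/-- The entry of a Latin square of order `6` which is written row by row in octal digits. -/
def cell (n x y : ℕ) : ℕ := oct 35 n (Nat.add (Nat.mul 6 x) y)

/-- The `r`-th one of `x`, `y` and `z`. -/
def sel (x y z r : ℕ) : ℕ :=
  match r with
  | 0 => x
  | 1 => y
  | _ => z

/-- Whether the triples `(u₀, u₁, u₂)` of `L` give triples `gᵢ(u_{ρ(i)})` of `R`. -/
noncomputable def mapsTriples (L R ρ g₀ g₁ g₂ : ℕ) : Bool :=
  force (oct 2 ρ 0) fun r₀ => force (oct 2 ρ 1) fun r₁ => force (oct 2 ρ 2) fun r₂ =>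
    (List.range 6).all fun x => (List.range 6).all fun y => force (cell L x y) fun z =>
      Nat.beq (cell R (oct 5 g₀ (sel x y z r₀)) (oct 5 g₁ (sel x y z r₁)))
        (oct 5 g₂ (sel x y z r₂))

/-- Latin squares of order `6`, written row by row in octal digits. -/
def tables : List ℕ :=
  -- The first sixteen tables define the nets `M i`; the other eleven agree with one of these off
  -- the hole and fill the hole differently.
  [0o012354120435201543345012534120453201, 0o012345120534201453345021453102534210,
    0o012345103254234501325410450123541032, 0o012345103254240513351402425031534120,
    0o012345103254234501325410451023540132, 0o012345103254240531354012425103531420,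
    0o012345103254240513351402425130534021, 0o012345103254240513354021435102521430,
    0o012345103254240513354021425130531402, 0o012345103254240531354012435120521403,
    0o012345103254234501345012450123521430, 0o012345103254234501345120451032520413,
    0o012345103452230514354021425103541230, 0o012345103254240513351402435021524130,
    0o012345103254240513351420435102524031, 0o012345103452230514345021451230524103,
    0o021354210435102543345012534120453201, 0o021345210534102453345021453102534210,
    0o102345021534210453345021453102534210, 0o102345013254234501325410450123541032,
    0o102345013254240513351402425031534120, 0o102345013254240513354021435102521430,
    0o102345013254234501345012450123521430, 0o102345013452230514354021425103541230,
    0o102345013254240513351402435021524130, 0o102345013254240513351420435102524031,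
    0o102345013452230514345021451230524103]

/-- The numbers of the nets to which the Latin squares `tables` belong. -/
def netNumbers : List ℕ :=
  [0, 1, 2, 3, 4, 5, 6, 7, 8, 9, 10, 11, 12, 13, 14, 15, 0, 1, 1, 2, 3, 7, 10, 12, 13, 14, 15]

/-- The main classes of the Latin squares `tables`. -/
def mainClasses : List ℕ :=
  [8, 8, 0, 1, 3, 6, 4, 7, 9, 10, 8, 11, 6, 4, 9, 10, 0, 1, 2, 3, 4, 10, 11, 5, 9, 6, 11]

/-- The permutations of `{0, 1, 2}`. -/
def rhos : List ℕ := [0o012, 0o021, 0o102, 0o120, 0o201, 0o210]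

/-- Isostrophisms from the Latin squares `tables` to the representatives of their main classes. -/
def mainClassMaps : List (ℕ × ℕ × ℕ × ℕ) :=
  [(0o012, 0o012345, 0o012345, 0o012354), (0o012, 0o021345, 0o345012, 0o345012),
    (0o012, 0o032541, 0o032541, 0o032541), (0o012, 0o012453, 0o012453, 0o012453),
    (0o012, 0o012345, 0o234501, 0o234501), (0o012, 0o012345, 0o012345, 0o012345),
    (0o012, 0o245310, 0o254130, 0o103542), (0o120, 0o012345, 0o012345, 0o012345),
    (0o120, 0o012345, 0o012354, 0o012354), (0o120, 0o243501, 0o243510, 0o105432),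
    (0o120, 0o031524, 0o304251, 0o304251), (0o120, 0o240153, 0o351042, 0o104253),
    (0o012, 0o025143, 0o025143, 0o025143), (0o012, 0o245310, 0o305214, 0o420153),
    (0o120, 0o021435, 0o021534, 0o021534), (0o012, 0o235401, 0o235401, 0o154023),
    (0o012, 0o024315, 0o024315, 0o042351), (0o012, 0o045123, 0o045123, 0o054123),
    (0o012, 0o012354, 0o012354, 0o102354), (0o012, 0o013245, 0o013245, 0o103245),
    (0o012, 0o012453, 0o012453, 0o102453), (0o120, 0o012453, 0o012453, 0o102453),
    (0o120, 0o013524, 0o104253, 0o014253), (0o012, 0o013452, 0o013452, 0o103452),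
    (0o021, 0o013524, 0o251043, 0o521043), (0o012, 0o014352, 0o235410, 0o325410),
    (0o012, 0o251043, 0o251043, 0o034251)]

/-- The permutations of `{0, …, 5}` which preserve `{0, …, m - 1}`, as lists of octal digits. -/
def holePerms (m : ℕ) : ℕ :=
  bif Nat.beq m 2 then
    0x22c688b1322b888ad422a8c8a9c225688953223a888d5222ac889d21d88875421ca8871521ab086a52158c855c214ac851d213b084e506c681b1306b881ad406a8c1a9c065681953063a818d5062ac189d05d88175405ca8171505ab016a50558c155c054ac151d053b014e5
  else
    0x4458d115c444ad111d443b110e540d8d035c40cad031d40bb102e52858ca15c284aca11d283b0a0e52158c855c214ac851d213b084e508d8c235c08cac231d08bb022e50558c155c054ac151d053b014e5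

/-- For each loop with a subloop `{0, …, m - 1}`, in lexicographical order, a Latin square in
`tables` and an isostrophism to it. -/
def loopMaps (m : ℕ) : ℕ :=
  bif Nat.beq m 2 then
    0x8cb2c4c32db1614514094514041451410c30c0b145142851450b2cb2c10e38e046cb6c2cb2cb026cb6c29d14513992982dd145162492409b0c3136c30c58924904914902cc30c047497429d25d0b492481030c30b0c30c121249130c30c0830c30a1497458e38e0b75d381691e9888614cb6a48f388c38c2d34cc667087120c30c09b0cb039b6d20d8492466430c1865066221161058494ce0f3cf48aaa3cb545140b3cf2d99432c19845842492490e30c303436d21874520e0e38e084923498b0e3168492450e9883838e381891611531490661249184aa2c60525d1975d20b4e38a2684584209249068c38c2892490338e20b645240e845841eaa8b0d749743892490d98e10e232cb167451451249206a8ea82092552615d10e1d145187451464e983187451456430c192cb2c2c8214669d39d212a93382493cb4976a05457462238ce0db145060916119514503ac32c099a610b45145062cb2c28514503145089851450814510b451450e9a60c3451450d145141cc30c0e1041122c32c0b1040d9924932d2613ce0100188145141545140d8458438b8ce18b1450645145092c38c5432db1952c2460e4a6198cb2c6091611630c3020c30c065144099b0c63832418e232cb149929838b2cb0d8c38c1d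b2db0eb2c243611610a30c1c99b6c62d30c18b4b2cb038c38c20b2cb0698e3860e38e098cb2c66a3aa0e75d503611610b6db30159199488e358b672a788596399ac5113848ea86457541838e383630e3092cb2c3924920b8cb58e1c35c88451259acb112d8c38c151451482c38c66a3aa09a924862184c0d492483892490ba56a520b6ec0552c58e06192663d53e20b2d12d3241461b0c31898e3865b0c3196c30c56124916514501ac32c086c30c524301380db04e0b2d7268c38c3830c3092613062a492194924836a3aa0b51458b41045661021220b8d138041052030c3050c30c34e38e0e924143430c30e0c30c1c92490a0c30c0e49012d0c304b430c0260c30c1830c3080cb6d59a5429630c303cd20d8b6cb6d2da68d2f42859e8c9161708f0a2cc30c4b6cb6d29a55a8a90c306a49160c68234e904166f6c30d5a330b96555543c30c34b505522d436c1760041e8d3532f914912cb48b8b0c30d2a33238ab55546986106fb0db030d9533a6c30c6a228a1a000625515d1898da645d13e999b95ba39b0c3170c30c3ca28a0f0010224000087b955a64b6990c44f463830c30ca46a6258458878a20c3e490a0f694683228800c60c6238749f99611025585d8892a20c68c90a1a094685c74878e2a2005d8300996db543e20a24b08c6a58a0a256945962e94417a8e350be58ef170db546955554b6926a2c23028a8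82892a9a416f363bc3232d43ab6d303cb2a39688a295a32238b28a292d450e2f05901ead5551756d306ac3ec8b2ca2e28a28a4ab4db52d4b0e3a04101bd55550cb9619e962168e525783230a30c7df5dbe92a98e410413461864e646653aeb874d6185935e18658bae19bcb0a3177c75dea929199588ba66c95e17018596061864da104161e1865904665656b8758b2c2cbc2b280c96508bdb6d10c6466525919947bd0bd3905e8596aca05ec50b3a0db445e53423a5d0bd6685e84e410412411995534b945cb8c93a09a10ea430c17641055685e849a10416575d74e7c31e655b47170056266228a1719e1de975d16f46901619041591817966f5d7586410561f7d14d94b9430b2c92f08210bcc30c0c410413af5d759041051c1041490050239f0df8eb6d1c30a28a0c1861dbd7bd17a041053477d158a69013410414e781793975d74d69a35bc51454a42858ea64a64ba90a83213a18abd75c6895098b145152d242a1768235e9d1455641058bd20d28b84e265975d70f3a64c5dd25d4b149755986102f3654de985c096406422ce38e0f749752980103a34d4dbe69930c38e392c04408b617622a638e1a858705cf46799ad7ae39d145177451469f1c71a0826a54f54f892587032b5d3993d13e3851450c145143c2102891c71c3c2082877087125d74f0cb4db538d56559a2800bdc21c4702a9432aa892f15d3c5d536d5934d352684003a108715655654e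62a945ea4893a4c64e3a71e78e34d3535a6934d840843082084e8a255be0208584a88031c21c4eaeb2936b4c87a9c73e6531ab9909a4d62534d58240845e020859aa8805c421c594eb296222957a2082136bac86f7041161554f6f3e70961c104592048166d555588a23d3420da997c71c5e214a995ef285c880a7a98e385e534d5901804e9c10455955952555554e2612ce902681756d3dea79c24d104113841044d8048138a88f58555553621628e0830a3871c70c20829befbca0c38e3830d34d4e00004bc4104471041126d55559a09a030924b2f9cf11ea886d1786148be80e88b75d5c3c0398967c07d2c701f5684948ea79c46f421b43057571a00e022985188b5d75d2df01f4a2948a65f7c20c6126031a39a8e9c89e25f7c50f68f6a1e69870f1df085c04981768e0a64a50a8e1df1469a3c2953a61c69a55a89bd75c5c47027a49230be11a18b247865afbce0f7c71d5871c74b10409bd2a8c3a5d75c3091c98aa91aa2d7bce1a1c71d2af42f4b65666259401952e30868d94b1a0d56c5c64c68e64d0664b8c117650661e81e8898e3083e594b0f6d56c3193598e8e3043064de9969a503e30e34b2c38d58335b96904922e84007a8a254be48ae1709a506945144b6d36e2e30e34a0cd0e2a8a006f322b83222953ab2c343e32cb5628b8a5a22628b2cb2d2d554f2fb14505c06017a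52c346ad3ad8b2cb2d28a2ca8ab0cb12d5b4f3a514503000016f6d40e58229a5634d343cc24c8b68a692db6cc2f4695de8d957170ce0e2cd34d4b6d46e29a29a4a94d346a59570c6c330e914576f88d2a59a08256514503c20824b544562d90517a54cb45cc3122f955952ca4ca8b88d8a2820824ab14506ad32d0c65945bcc9123a682086a32cb1a0416655059089bd4be3903a89989b605da08217082083cb2cb0f040062410418740e4238a6d80cbd45e6420820c78659e8a0e217a0b4266d91f175c9be66fbc76f1c71d341657585ef196001d8597c71d669451585647c3172578e79e59be20e20ca0ba23af5c77abef193581d84e1c71d3914514d7c71d6196574d9240cbda6900cb6d28bc3b690c607611d81d849456a566e46e4e09a405e43033a6eda45ed54a3aa56a539646e5900761551451490db14ea534d1730a905ca8883aa56a525800055596593a94515959641bc11199952c185de086991df19ea32cb1779e4135800058b965960701f5960001650a01580c314bcd34d0c90a9030a2882fb96596514514e00001240000475ae41eacb060c7827a3811018e1c719bcb2cb0c5965935f01f4e000013a8a014d19e416000004d804801584588880848e0e38e48aeb38b4e38a66555542e01200954db464d34d0d2082038269318a06a221c70f0582048b6b4ce38492359a20a20b7497522d36d0e34d3425a6930d9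4d346202081970424e134cc263cf3c220208142828858f9c9383cf3c18d56519204805602081810870653aca1871c24b60120083cf2c98820806208200e20a20a3cf24b60120079559439c21c0eaeb283482080d9cf14e1c1041488a285934d306208509ab3eb0811c14e1c104183e70861c1041994d3465c10415992992092556628a282d3ad23820838b4872b054164220812019b555462288f0db4db42555550e9e714b4410406104100ca28a0a104102041032610414b679c20d104103841040d34d3438410407145099ad36d0b145152134d22d22038e00040881041014a88f18804803955550d1041026d5551908a685a228a13104100955550434d342c410404104102841040b28a2811a29a0b3cf3c11a29a0a28a2809c104139d39c2dc104162082009a08216682084e55650b2082010d34d047087029c21c0b082082d34d304082081202081308208282082021087058f3cf0b8048028a28a0d9d39c39a29a0e882881edb480d28a280cd3472d69a1cb4d3462628a281a20a2082048058229a1928288555b481888a2860f4e71934d3418d34d0888a2850d947386821ce1555126804802e73cf1888a2864f3cf0971c5436b3eb0e6076121a68d05b5540e175cf6698b9a2228972d4d34c2c4715184cfac64f3cf0d28a283a20a209b6d40b504086674c7622229738410412220a205208202eb3eb092828866b4d3184d34c3a080d0d29ab41685e84828a40b4e50e881c74d995b5738808205a73cf196820860d944186820855a0821928a589826803894d00e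1a08214b4db421555506acfac2c208209882883ab4d319220346134d30d2a240e050c588000119955572d0820814000048208202a59440d3cf3c3820820d082081c20820e0820820208206082049820802d96500b420820350cb164470e1730c3124525d55a5104ea45244e66b905eb4c83a7497526c32c4e71c3830c52459749751e9a412f06b9032bac82f249253a00600c6db4934c30c4d9869a3921d28e849256238d46faaa2d35d25d4e4e98432a4897a849256480601790c316036d258487aa66618e994aa2d60525d59ae9845c92494d8cb51eaaa896f7451561d145593a60d61450e6f8e33936c514582458564309b99786185e310b992612de96b8b17745155416403a90c316673cf17514513a452449448a45c880a3a145153a69834d52c39e851454d5145134b8ce58845853a31238e0c20e3861860cbae2c30924b6f145151c10402f30c3138f3cf0cb14516451454920828be92290c6db31bd1a573a104112ab46b0c9d39d2e03e08ab96586885488b4d1ac5c41044b6c331e914572f704115930938b80f225965960f64144e9c21c4a30c49be79d20c3cf3d2d95998a050062e73cf1a3e7485dc21c4b65944bc421c5632449e911d18b6560658f3cf0fa96aa38e42699819745dc104177041069e1861a0c36e54e50e893903a3aa59299219743041040c104103c314389186183c30c38704f062847161a655662e02133a460b03269856f781792965964ba42a62c13d99671c583e982c1798e15ea08132f1817959e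05e4b9899a2679c60f6ce6e1de7840f2d58e65b3db8e6536431e7830c3e71869b3839519e1069b51b896cf0e6414d91719e0c5cb54b8ebae3c3c81a096807822ee596174d334bc57437a186192de186565ae3c6ab42b8b20622293acd3a1450dbd65960cb91b92c61864a0cb6d56e5863a9929938e38e4948ea965cba6179cf10e8164c170cb6d654b09582cb2d36638e58b2c2dbe32cb5915d5162e9e31784949e942ac99184785e420c996cb6d1eeb862f3929966a3aa4e12e9831b2db499e710bd964c0c6cb6d3a32cb58b2c2535d7544d38e3936c50b7a2cb2d3a18526f5a78c31e11e0c908923942948e2c38d653ac917a924962184c4d2e325e8c905586c30d621049991407665b0c359808205d248c6f992992524924e98e3964f1a7176c30d5467873aa51445c47023a8c38d3abac90c2613160b2c96f492493430c34d924153450058e841863830c34e20820312a8c7a0c30d26a4925938e393a71a70c0c30d1c61872f10408bd14510c78658ea01204a3dea83249036f4d34d2c44448a717722c16531a220145dd445992572638459c174692069d49d8974c165488011a79e58bc8120569dea85e01204b90c0dea70278b111725996530f820143095e1997517639c59c0ca69203dd31d87820043e42e4890db15e882084bad34c5d65902f808215abad10f1887a59e29e8bacfad2c30c56f4d34c316b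903a208212ae36e8b4eb446862068a7917a2865c68bad34c6ae3ee0c75d39bcf9d53a041052a95a94b5805a2de446964d34c3dd14e7a3cf54bd63ee17041052d904156713722a94511a10d122dc10f3a38e51be9a540c646652914514b3ca3e2dc4c496451443dc70f2f469505ce9947a646652c119956808206990411a1457654c48c8979c6c5cc36499641045ec4ec8e208203c50c589041043c51458719c6c32c4d49930d323810410c261105c85888e710126455dd174282469c4dc892610069c344958458529f1d73a39fac3259426f492492dd59d8b150162806121a8611031c41c8e2168265d5dd0ca28243e18400f70d721e52a5892458559f7d72f99fac5e11614b94d09e8541d969819a2d86120f249252c26847aa92485e1249565d744bdf2df8b1c97e5aaa900f08211bea3aa4b492483092494a5ef44e872478a4aa406af32f8b08a6964a28a4d56d2162db4a6f9cf3d62228a5911c556202137abe6885d52ed999493664715f17bd71ce8229a559d39d38f3cf4976f9c5d33eb5998e14e8060d1768a693adb484d88a2961c7154db5529e8f3cf4d28a293979a20c8204dbe52658e7c57c3152d58ebef1cbda29a473d39d645be70cacfad39a29a499a614bd860d0c9d39d2534d34e387985e73cf591df18e9a08255a10405c57433a4aa205ca0a259ad34d60a8887a8203534405c998002265a0825836511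62124917682096534cd6f0820926b4d3599879830f3cf4e1c718bc2082471450cbd04100caaa203220a24e28a21bc880d584d34d3600208e101123a59444d082093492490c08209393acd7a74538ea8a150c3cf55bdd49d8aa10406853058b410412d81d84a75d38bcf9d57a428545ce2ce8b752165904100f007615981d84b7043de8e3942f5cebc5df407965c15e2d24920f600015800004bbcebc31c70f6f3a650e875878b7d07e2aa4921aa17a12c00004a7dd685cd32599600005ed4ad8e849246980001a1047254d4cd891dd6832d4959934c363800000c249243c408489000003c41048730c3120c307664104034061618bae30b461860e7817815e05e0978650e1742f1968f6a2175d70b4512cb591990e1861818618603bae1c3461860d7817821e05e074512499964b2da17a039f01f0a5144199b2db486185836841018b9630e1e1861979e50b6f42f0e94896219651054104025f01f0b4692ce0119919786185114510678618616b87185963899904b38417a0651451081817854701f16b91b8219041150590ce2841019186489965960664104511a401864104629443386410465f1c716199b816f42f093533620618c2d5d75c396b943818178664524482cb5d9af5d7187df443471c70b0410cb504100e0411498104108041041c104103041041810410da6900369a432d041043871c70a0840a20678c38bd75c64104105041042565942d781783830c0660c30d2077d1185d75c36f42f0b1c71c36fbc60d1c71c0c71c7066076039040a2d7c07c1df01f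08a56a439860a2d4102099e05e0a1c71c3afbcd2d0595c6114510d34d1998d34d487c07c25f01f056ce6e21646e197c754e165960b5ef1861f1c7184104019f1c71400760650a0a38456a465800a385d73c98701f154104020605e167c71c66f5cd38a51446196570d68a69215551669099222e46e0e7df54b51451096184015e05e0bb91b824762f05596583871cd2d3123221e7900db965860a296669559520701f195ef54e061860b6000056f42f081c74c9a94511901808e1800019a1008e180001842804618000145d75c19e18616b96586477cd380c50e20000009000001565960d19e40602082480820599f01f0e5d754b6e46e0b000109914510e00008b4000007000002000000ea2808b68a010d0000034000006000000c61860a041042c10410a410402c01d8167c71c4c1041025d75c10104104641045a95a90b607602981d80b1c71c111451041c71c09904113646642991990b600005a85e80b18618098000131861811041004451442c119916000002c00000a5965810000004786184c000002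
  else
    0x204104114416134d088450c30008410012489215961984b0c3101c0004071c16100018841000000842080d34b014c71c48b2456020a0980c00012492100450cb200401c800000011800044718160288118121861230c2804314920102288134c501341044892c360187018070411104104040046201020800c303214100184914510282084175c7614d3208431450000104001047211860184604110

/-- The size of the hole of the Latin squares in `tables`. -/
def holeSize (a : ℕ) : ℕ := bif Nat.ble (netNumbers.getD a 0) 1 then 3 else 2

/-- The `i`-th permutation in `holePerms m`. -/
def holePerm (m i : ℕ) : ℕ := holePerms m / 8 ^ (6 * i) % 8 ^ 6

/-- The number of permutations in `holePerms m`. -/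
def holePermCount (m : ℕ) : ℕ := bif Nat.beq m 2 then 48 else 36

/-- Whether `c` encodes an isostrophism from `L` to one of the Latin squares in `tables`. -/
noncomputable def isLoopMap (m L c : ℕ) : Bool :=
  force (c % 32) fun a => force (c / 32 % 8) fun s => force (c / 256 % 64) fun i₀ =>
  force (c / 16384 % 64) fun i₁ => force (c / 1048576) fun i₂ =>
  force (holePerm m i₀) fun g₀ => force (holePerm m i₁) fun g₁ => force (holePerm m i₂) fun g₂ =>
    Nat.blt a 27 && Nat.blt s 6 && Nat.blt i₀ (holePermCount m) && Nat.blt i₁ (holePermCount m) &&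
      Nat.blt i₂ (holePermCount m) && Nat.beq (holeSize a) m &&
      mapsTriples L (tables.getD a 0) (rhos.getD s 0) g₀ g₁ g₂

/-! ### Enumeration of loops -/

/-- The bits which stand for the symbol `0` in the row `x` and in the column `y`. -/
def cellMask (x y : ℕ) : ℕ :=
  Nat.add (Nat.pow 2 (Nat.mul 6 x)) (Nat.pow 2 (Nat.add 36 (Nat.mul 6 y)))

/-- Puts the symbols `v ∈ d` into a cell with mask `b` and continues with `next`. -/
noncomputable def tryAll (next : ℕ → ℕ → ℕ → (ℕ → Bool) → Bool) (b acc used : ℕ) (d : List ℕ)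
    (k : ℕ → Bool) : ℕ → Bool :=
  -- The search over the remaining symbols is the continuation of the branch of `v`, so that it
  -- receives the certificates which this branch leaves over.
  List.rec k (fun v _ k c => force (Nat.mul b (Nat.pow 2 v)) fun b =>
    Bool.rec (k c) (force (Nat.lor used b) fun u => force (Nat.add (Nat.mul acc 8) v) fun a =>
      next a u c k) (Nat.beq (Nat.land used b) 0)) d

/-- Depth-first search for Latin squares. The cells `(x, y)` are filled with the given symbols,
`c` is a list of certificates for the Latin squares, and `k` is the continuation. -/
noncomputable def latinSearch (leaf : ℕ → ℕ → Bool) (s : ℕ) (t : List (ℕ × ℕ × List ℕ)) :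
    ℕ → ℕ → ℕ → (ℕ → Bool) → Bool :=
  List.rec (fun acc _ c k => leaf acc (c % s) && force (c / s) k)
    (fun p _ next acc used c k =>
      force (cellMask p.1 p.2.1) fun b => tryAll next b acc used p.2.2 k c) t

/-- The symbols which may occur in the cell `(x, y)` of a loop with subloop `{0, …, m - 1}`. -/
def symbols (m x y : ℕ) : List ℕ :=
  bif Nat.beq x 0 then [y] else bif Nat.beq y 0 then [x] else
  bif Nat.blt x m then
    bif Nat.blt y m then bif Nat.beq m 2 then [0, 1] else [0, 1, 2]
    else bif Nat.beq m 2 then [2, 3, 4, 5] else [3, 4, 5]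
  else
    bif Nat.blt y m then bif Nat.beq m 2 then [2, 3, 4, 5] else [3, 4, 5]
    else [0, 1, 2, 3, 4, 5]

/-- The cells of a loop with the symbols which may occur in them. -/
def loopCells (m : ℕ) : List (ℕ × ℕ × List ℕ) :=
  (List.range 36).map fun i => (i / 6, i % 6, symbols m (i / 6) (i % 6))

-- Each leaf of the search takes the next `26` bits of `loopMaps`: `5` for the table, `3` for the
-- permutation of the coordinates, and `6` for each of the three hole permutations. Success means
-- that every loop reached has a valid certificate.
set_option maxRecDepth 100000 in
theorem latinSearch_two :
    latinSearch (isLoopMap 2) (2 ^ 26) (loopCells 2) 0 0 (loopMaps 2) (fun _ => true) = true := by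
  decide +kernel

set_option maxRecDepth 100000 in
theorem latinSearch_three :
    latinSearch (isLoopMap 3) (2 ^ 26) (loopCells 3) 0 0 (loopMaps 3) (fun _ => true) = true := by
  decide +kernel

/-! ### Correctness of the search for Latin squares -/

theorem tryAll_cons (next : ℕ → ℕ → ℕ → (ℕ → Bool) → Bool) (b acc used v : ℕ) (d : List ℕ)
    (k : ℕ → Bool) (c : ℕ) : tryAll next b acc used (v :: d) k c =
      if used &&& b * 2 ^ v = 0 then
        next (acc * 8 + v) (used ||| b * 2 ^ v) c (tryAll next b acc used d k)
      else tryAll next b acc used d k c := by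
  have h : tryAll next b acc used (v :: d) k c = force (b * 2 ^ v) fun b' =>
      Bool.rec (tryAll next b acc used d k c) (force (Nat.lor used b') fun u =>
        force (acc * 8 + v) fun a => next a u c (tryAll next b acc used d k))
        (Nat.beq (Nat.land used b') 0) := rfl
  rw [h]
  simp only [force_eq]
  split_ifs with h0
  · have hb : Nat.beq (Nat.land used (b * 2 ^ v)) 0 = true := (Nat.beq_eq ..).mpr h0
    rw [hb]
    rfl
  · have hb : Nat.beq (Nat.land used (b * 2 ^ v)) 0 = false :=
      Bool.eq_false_iff.2 fun h' => h0 ((Nat.beq_eq ..).mp h')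
    rw [hb]

/-- A search can only succeed by eventually calling its continuation successfully. This is what
guarantees that later branches are really visited. -/
theorem exists_of_tryAll {next : ℕ → ℕ → ℕ → (ℕ → Bool) → Bool}
    (hn : ∀ a u c k, next a u c k = true → ∃ c', k c' = true) {b acc used : ℕ} {k : ℕ → Bool}
    (d : List ℕ) {c : ℕ} (h : tryAll next b acc used d k c = true) : ∃ c', k c' = true := by
  induction d generalizing c with
  | nil => exact ⟨c, h⟩
  | cons v d ih =>
    rw [tryAll_cons] at h
    split_ifs at h
    · obtain ⟨c', h'⟩ := hn _ _ _ _ h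
      exact ih h'
    · exact ih h

/-- No admissible symbol is skipped: the branches of earlier symbols succeed only through the
continuation, which goes on to `v`. -/
theorem exists_next_of_tryAll {next : ℕ → ℕ → ℕ → (ℕ → Bool) → Bool}
    (hn : ∀ a u c k, next a u c k = true → ∃ c', k c' = true) {b acc used : ℕ} {k : ℕ → Bool}
    {d : List ℕ} {c : ℕ} (h : tryAll next b acc used d k c = true) {v : ℕ} (hv : v ∈ d)
    (hu : used &&& b * 2 ^ v = 0) :
    ∃ c' k', next (acc * 8 + v) (used ||| b * 2 ^ v) c' k' = true := by
  induction d generalizing c with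
  | nil => simp at hv
  | cons w d ih =>
    rw [tryAll_cons] at h
    rcases List.mem_cons.1 hv with rfl | hv
    · rw [if_pos hu] at h
      exact ⟨_, _, h⟩
    · split_ifs at h
      · obtain ⟨c', h'⟩ := hn _ _ _ _ h
        exact ih h' hv
      · exact ih h hv

theorem exists_of_latinSearch {leaf : ℕ → ℕ → Bool} {s : ℕ} (t : List (ℕ × ℕ × List ℕ)) :
    ∀ acc used c k, latinSearch leaf s t acc used c k = true → ∃ c', k c' = true := by
  induction t with
  | nil =>
    intro acc used c k h
    have h' : (leaf acc (c % s) && force (c / s) k) = true := h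
    rw [Bool.and_eq_true, force_eq] at h'
    exact ⟨_, h'.2⟩
  | cons p t ih =>
    intro acc used c k h
    have h' : (force (cellMask p.1 p.2.1) fun b =>
      tryAll (latinSearch leaf s t) b acc used p.2.2 k c) = true := h
    rw [force_eq] at h'
    exact exists_of_tryAll ih _ h'

/-- The search finds every function with disjoint masks. -/
theorem exists_leaf_of_latinSearch {leaf : ℕ → ℕ → Bool} {s : ℕ} (f : ℕ → ℕ → ℕ)
    (t : List (ℕ × ℕ × List ℕ)) {acc used c : ℕ} {k : ℕ → Bool}
    (h : latinSearch leaf s t acc used c k = true) (hf : ∀ p ∈ t, f p.1 p.2.1 ∈ p.2.2)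
    (ht : t.Pairwise fun p q => (cellMask p.1 p.2.1 * 2 ^ f p.1 p.2.1) &&&
      (cellMask q.1 q.2.1 * 2 ^ f q.1 q.2.1) = 0)
    (hu : ∀ p ∈ t, used &&& (cellMask p.1 p.2.1 * 2 ^ f p.1 p.2.1) = 0) :
    ∃ c', leaf (t.foldl (fun a p => a * 8 + f p.1 p.2.1) acc) c' = true := by
  induction t generalizing acc used c k with
  | nil =>
    have h' : (leaf acc (c % s) && force (c / s) k) = true := h
    rw [Bool.and_eq_true] at h'
    exact ⟨_, h'.1⟩
  | cons p t ih =>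
    have h' : (force (cellMask p.1 p.2.1) fun b =>
      tryAll (latinSearch leaf s t) b acc used p.2.2 k c) = true := h
    rw [force_eq] at h'
    obtain ⟨c', k', hn⟩ := exists_next_of_tryAll (exists_of_latinSearch t) h'
      (hf p List.mem_cons_self) (hu p List.mem_cons_self)
    rw [List.pairwise_cons] at ht
    refine ih hn (fun q hq => hf q (List.mem_cons_of_mem _ hq)) ht.2 fun q hq => ?_
    rw [Nat.and_or_distrib_right, hu q (List.mem_cons_of_mem _ hq), ht.1 q hq]
    rfl

/-- For `x < 6` the row bit lies strictly below the column bit, so the sum has no carry and is a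
bitwise "or". -/
theorem cellMask_mul (x y v : ℕ) (hx : x < 6) :
    cellMask x y * 2 ^ v = 2 ^ (36 + 6 * y + v) ||| 2 ^ (6 * x + v) := by
  have h := Nat.two_pow_add_eq_or_of_lt (i := 36 + 6 * y + v) (b := 2 ^ (6 * x + v))
    (Nat.pow_lt_pow_right (by lia) (by lia)) 1
  rw [mul_one] at h
  rw [← h]
  change (2 ^ (6 * x) + 2 ^ (36 + 6 * y)) * 2 ^ v = _
  rw [add_mul, ← pow_add, ← pow_add, add_comm]

/-- Bit `6x + v` records the symbol `v` in row `x` and bit `36 + 6y + v` records it in column `y`.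
Row bits stay below `36`, so two masks meet only if a symbol is repeated in a row or a column. -/
theorem cellMask_disjoint {x y v x' y' v' : ℕ} (hx : x < 6) (hx' : x' < 6) (hv : v < 6)
    (hv' : v' < 6) (h₁ : x = x' → v ≠ v') (h₂ : y = y' → v ≠ v') :
    cellMask x y * 2 ^ v &&& cellMask x' y' * 2 ^ v' = 0 := by
  rw [cellMask_mul x y v hx, cellMask_mul x' y' v' hx']
  refine Nat.eq_of_testBit_eq fun i => ?_
  simp only [Nat.testBit_and, Nat.testBit_or, Nat.testBit_two_pow, Nat.zero_testBit,
    Bool.and_eq_false_imp, Bool.or_eq_true, decide_eq_true_eq, Bool.or_eq_false_iff,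
    decide_eq_false_iff_not]
  lia

/-- Each step of the fold appends one octal digit. As digits are below `8` there are no carries, and
digit `i` ends up with `n - i` digits to its right. -/
theorem foldl_digit (g : ℕ → ℕ) (hg : ∀ i, g i < 8) (n i : ℕ) (hi : i ≤ n) :
    (List.range (n + 1)).foldl (fun a i => a * 8 + g i) 0 / 8 ^ (n - i) % 8 = g i := by
  induction n with
  | zero =>
    obtain rfl : i = 0 := by lia
    simpa using Nat.mod_eq_of_lt (hg 0)
  | succ n ih =>
    rw [List.range_succ, List.foldl_append]
    simp only [List.foldl_cons, List.foldl_nil]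
    rcases Nat.lt_or_ge n i with h | h
    · obtain rfl : i = n + 1 := by lia
      rw [Nat.sub_self, pow_zero, Nat.div_one, mul_comm, Nat.mul_add_mod]
      exact Nat.mod_eq_of_lt (hg _)
    · rw [show n + 1 - i = (n - i) + 1 by lia, pow_succ', ← Nat.div_div_eq_div_mul, mul_comm _ 8,
        Nat.mul_add_div (by lia), Nat.div_eq_of_lt (hg _), add_zero]
      exact ih h

/-- The table of an operation in octal digits. -/
def pack (op : Fin 6 → Fin 6 → Fin 6) : ℕ :=
  (List.range 36).foldl (fun a i => a * 8 + op (Fin.ofNat 6 (i / 6)) (Fin.ofNat 6 (i % 6))) 0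

theorem cell_pack (op : Fin 6 → Fin 6 → Fin 6) (x y : Fin 6) : cell (pack op) x y = op x y := by
  have h := foldl_digit (fun i => (op (Fin.ofNat 6 (i / 6)) (Fin.ofNat 6 (i % 6)) : ℕ))
    (fun i => by lia) 35 (6 * x + y) (by lia)
  refine h.trans ?_
  have hx : Fin.ofNat 6 ((6 * x + y : ℕ) / 6) = x := by
    ext
    simp
    lia
  have hy : Fin.ofNat 6 ((6 * x + y : ℕ) % 6) = y := by
    ext
    simp
  simp only [hx, hy]

/-- The restriction of the search to `symbols` loses no loop: the identity fixes the first row and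
column, and a product with one factor in the hole is in the hole exactly if the other factor is. -/
theorem mem_symbols : ∀ m : ℕ, m = 2 ∨ m = 3 → ∀ x y v : Fin 6, (x = 0 → v = y) →
    (y = 0 → v = x) → ((x : ℕ) < m → ((v : ℕ) < m ↔ (y : ℕ) < m)) →
    ((y : ℕ) < m → ((v : ℕ) < m ↔ (x : ℕ) < m)) → (v : ℕ) ∈ symbols m x y := by
  rintro m (rfl | rfl) <;> decide +kernel

theorem sel_eq (u : Fin 3 → Fin 6) (j : Fin 3) :
    sel (u 0) (u 1) (u 2) j = u j := by
  fin_cases j <;> rfl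

theorem mapsTriples_sound {L R ρ g₀ g₁ g₂ : ℕ} (h : mapsTriples L R ρ g₀ g₁ g₂ = true)
    {op op' : Fin 6 → Fin 6 → Fin 6} (hL : ∀ x y : Fin 6, cell L x y = op x y)
    (hR : ∀ x y : Fin 6, cell R x y = op' x y) {τ : Equiv.Perm (Fin 3)}
    (hτ : ∀ i : Fin 3, oct 2 ρ i = τ i) {γ : Fin 3 → Equiv.Perm (Fin 6)}
    (h₀ : ∀ v : Fin 6, oct 5 g₀ v = γ 0 v) (h₁ : ∀ v : Fin 6, oct 5 g₁ v = γ 1 v)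
    (h₂ : ∀ v : Fin 6, oct 5 g₂ v = γ 2 v) (u : Fin 3 → Fin 6) (hu : u ∈ graph op) :
    (fun i => γ i (u (τ i))) ∈ graph op' := by
  have t0 := hτ 0
  have t1 := hτ 1
  have t2 := hτ 2
  simp only [Fin.val_zero, Fin.val_one, Fin.val_two] at t0 t1 t2
  simp only [mapsTriples, force_eq, List.all_eq_true, List.mem_range, Nat.beq_eq, t0, t1, t2] at h
  have h' := h (u 0) (u 0).isLt (u 1) (u 1).isLt
  have hu' : op (u 0) (u 1) = u 2 := hu
  rw [hL, hu', sel_eq, sel_eq, sel_eq, h₀, h₁, h₂, hR] at h'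
  exact Fin.ext h'

/-- Whether the `k + 1` octal digits of `g` form a permutation. -/
def IsOctPerm (k g : ℕ) : Prop :=
  (∀ v : Fin (k + 1), oct k g v < k + 1) ∧
    ∀ v w : Fin (k + 1), oct k g v = oct k g w → v = w

instance (k g : ℕ) : Decidable (IsOctPerm k g) := by
  unfold IsOctPerm
  infer_instance

theorem IsOctPerm.exists_perm {k g : ℕ} (h : IsOctPerm k g) :
    ∃ γ : Equiv.Perm (Fin (k + 1)), ∀ v : Fin (k + 1), oct k g v = γ v :=
  ⟨Equiv.ofBijective (fun v => ⟨oct k g v, h.1 v⟩)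
    (Finite.injective_iff_bijective.1 fun v w e => h.2 v w (congrArg Fin.val e)), fun _ => rfl⟩

/-- There are `2! · 4! = 48` and `3! · 3! = 36` permutations preserving the hole. Only their
validity is checked, since the certificates need no completeness of the list. -/
theorem isOctPerm_holePerm : ∀ m, m = 2 ∨ m = 3 → ∀ i < holePermCount m,
    IsOctPerm 5 (holePerm m i) ∧
      ∀ v : Fin 6, (v : ℕ) < m ↔ oct 5 (holePerm m i) v < m := by
  rintro m (rfl | rfl) <;> decide +kernel

theorem isOctPerm_rhos : ∀ s < 6, IsOctPerm 2 (rhos.getD s 0) := by decide +kernel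

/-- The Latin squares in `tables`. -/
def tableOp (a : ℕ) (x y : Fin 6) : Fin 6 := Fin.ofNat 6 (cell (tables.getD a 0) x y)

theorem cell_tables : ∀ a < 27, ∀ x y : Fin 6,
    cell (tables.getD a 0) x y = tableOp a x y := by
  decide +kernel

theorem isHoley_tableOp : ∀ a < 27, IsHoley (holeSize a) (tableOp a) := by
  have h₁ : ∀ a < 27, ∀ x y y' : Fin 6, tableOp a x y = tableOp a x y' → y = y' := by
    decide +kernel
  have h₂ : ∀ a < 27, ∀ x x' y : Fin 6, tableOp a x y = tableOp a x' y → x = x' := by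
    decide +kernel
  have h₃ : ∀ a < 27, ∀ x y : Fin 6, (x : ℕ) < holeSize a →
      ((tableOp a x y : ℕ) < holeSize a ↔ (y : ℕ) < holeSize a) := by
    decide +kernel
  exact fun a ha => ⟨⟨fun x => Finite.injective_iff_bijective.1 fun y y' => h₁ a ha x y y',
    fun y => Finite.injective_iff_bijective.1 fun x x' => h₂ a ha x x' y⟩, h₃ a ha⟩

/-- In a Latin square the masks of different cells are disjoint, so the search follows the entries
of `op` down to a leaf, where the accumulated digits are `pack op`. -/
theorem IsHoleyLoop.exists_isLoopMap {m : ℕ} (hm : m = 2 ∨ m = 3) {op : Fin 6 → Fin 6 → Fin 6}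
    (h : IsHoleyLoop m op) : ∃ c, isLoopMap m (pack op) c = true := by
  let f : ℕ → ℕ → ℕ := fun x y => op (Fin.ofNat 6 x) (Fin.ofNat 6 y)
  have hs : latinSearch (isLoopMap m) (2 ^ 26) (loopCells m) 0 0 (loopMaps m) (fun _ => true) =
      true := by
    rcases hm with rfl | rfl
    exacts [latinSearch_two, latinSearch_three]
  have hval : ∀ x < 6, ((Fin.ofNat 6 x : Fin 6) : ℕ) = x := fun x hx => by
    simpa using Nat.mod_eq_of_lt hx
  have hmem : ∀ p ∈ loopCells m, p.1 < 6 ∧ p.2.1 < 6 ∧ p.2.2 = symbols m p.1 p.2.1 := by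
    intro p hp
    obtain ⟨i, hi, rfl⟩ := List.mem_map.1 hp
    rw [List.mem_range] at hi
    exact ⟨by lia, by lia, rfl⟩
  have hf : ∀ p ∈ loopCells m, f p.1 p.2.1 ∈ p.2.2 := by
    intro p hp
    obtain ⟨hx, hy, e⟩ := hmem p hp
    rw [e]
    have := mem_symbols m hm (Fin.ofNat 6 p.1) (Fin.ofNat 6 p.2.1)
      (op (Fin.ofNat 6 p.1) (Fin.ofNat 6 p.2.1)) (fun h0 => by rw [h0, h.zero_left])
      (fun h0 => by rw [h0, h.zero_right]) (h.closed _ _) (h.closed_right _ _)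
    rwa [hval _ hx, hval _ hy] at this
  have hne : (loopCells m).Pairwise fun p q => (p.1, p.2.1) ≠ (q.1, q.2.1) := by
    rw [loopCells, List.pairwise_map]
    refine List.nodup_range.imp fun {i j} hij e => hij ?_
    simp only [Prod.mk.injEq] at e
    lia
  obtain ⟨c, hc⟩ := exists_leaf_of_latinSearch f (loopCells m) hs hf
    (hne.imp_of_mem fun {p q} hp hq hpq => by
      obtain ⟨hpx, hpy, -⟩ := hmem p hp
      obtain ⟨hqx, hqy, -⟩ := hmem q hq
      refine cellMask_disjoint hpx hqx (Fin.isLt _) (Fin.isLt _) (fun e h' => ?_) fun e h' => ?_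
      · simp only [f, e] at h'
        have := congrArg Fin.val ((h.quasigroup.left_bijective _).1 (Fin.ext h'))
        rw [hval _ hpy, hval _ hqy] at this
        exact hpq (by rw [e, this])
      · simp only [f, e] at h'
        have := congrArg Fin.val ((h.quasigroup.right_bijective _).1 (Fin.ext h'))
        rw [hval _ hpx, hval _ hqx] at this
        exact hpq (by rw [e, this])) fun p _ => Nat.zero_and _
  rw [loopCells, List.foldl_map] at hc
  exact ⟨c, hc⟩

/-- The certificate decodes to permutations that preserve the hole, so the same data give the
isostrophism and the isomorphism of nets. -/
theorem IsHoleyLoop.exists_tableOp {m : ℕ} (hm : m = 2 ∨ m = 3) {op : Fin 6 → Fin 6 → Fin 6}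
    (h : IsHoleyLoop m op) : ∃ a < 27, holeSize a = m ∧ Isostrophic op (tableOp a) ∧
      Isomorphic (net m op) (net m (tableOp a)) := by
  obtain ⟨c, hc⟩ := h.exists_isLoopMap hm
  simp only [isLoopMap, force_eq, Bool.and_eq_true, Nat.blt_eq, Nat.beq_eq] at hc
  obtain ⟨⟨⟨⟨⟨⟨ha, hs⟩, hi₀⟩, hi₁⟩, hi₂⟩, hh⟩, hc⟩ := hc
  generalize c % 32 = a at *
  obtain ⟨τ, hτ⟩ := (isOctPerm_rhos _ hs).exists_perm
  obtain ⟨p₀, q₀⟩ := isOctPerm_holePerm m hm _ hi₀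
  obtain ⟨p₁, q₁⟩ := isOctPerm_holePerm m hm _ hi₁
  obtain ⟨p₂, q₂⟩ := isOctPerm_holePerm m hm _ hi₂
  obtain ⟨γ₀, e₀⟩ := p₀.exists_perm
  obtain ⟨γ₁, e₁⟩ := p₁.exists_perm
  obtain ⟨γ₂, e₂⟩ := p₂.exists_perm
  let γ : Fin 3 → Equiv.Perm (Fin 6) := ![γ₀, γ₁, γ₂]
  have hT := graph_iff_of_forall (isHoley_tableOp a ha).quasigroup τ.symm γ fun u hu =>
    mapsTriples_sound hc (cell_pack op) (cell_tables a ha) (τ := τ) hτ (γ := γ) e₀ e₁ e₂ u hu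
  refine ⟨a, ha, hh, ⟨τ.symm, γ, hT⟩, ?_⟩
  refine isomorphic_netOf pt_bijective pt_bijective τ.symm γ hT fun i v => ?_
  rw [pt_mem_hole, pt_mem_hole]
  have hγ : ∀ (j : Fin 3) (v : Fin 6), (v : ℕ) < m ↔ (γ j v : ℕ) < m := by
    intro j v
    fin_cases j
    · exact (q₀ v).trans (by rw [e₀]; rfl)
    · exact (q₁ v).trans (by rw [e₁]; rfl)
    · exact (q₂ v).trans (by rw [e₂]; rfl)
  exact hγ _ v

theorem mainClassMaps_spec : ∀ a : Fin 27, ∃ k : Fin 12, (k : ℕ) = mainClasses.getD a 0 ∧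
    match mainClassMaps.getD a (0, 0, 0, 0) with
    | (ρ, g₀, g₁, g₂) => IsOctPerm 2 ρ ∧ IsOctPerm 5 g₀ ∧ IsOctPerm 5 g₁ ∧ IsOctPerm 5 g₂ ∧
        force (pack (denesKeedwell k)) (fun R =>
          mapsTriples (tables.getD a 0) R ρ g₀ g₁ g₂) = true := by
  decide +kernel

/-! ### Isomorphisms of nets -/

/-- The pair of points `(a, b)` on a line with `c`, as an entry of a table of third points. -/
def thirdEntry (a b c : ℕ) : ℕ :=
  Nat.mul (Nat.succ c) (Nat.pow 32 (Nat.add (Nat.mul 18 a) b))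

/-- The table of third points on the lines of a net. -/
noncomputable def thirdTable (m R : ℕ) : ℕ :=
  (List.range 6).foldl (fun T x => (List.range 6).foldl (fun T y =>
    -- Products inside the hole give no line. Every other line is entered for all six ordered pairs
    -- of its points, numbered `x`, `6 + y`, `12 + z` as by `pt`.
    bif Nat.blt x m && Nat.blt y m then T else
      force (12 + cell R x y) fun c => force (6 + y) fun b => force T fun T =>
        T + (thirdEntry x b c + thirdEntry b x c + thirdEntry x c b + thirdEntry c x b +
          thirdEntry b c x + thirdEntry c b x)) T) 0

/-- One more than the third point on the line through `a` and `b`, or `0` if there is no line. -/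
def third (T a b : ℕ) : ℕ :=
  Nat.mod (Nat.div T (Nat.pow 32 (Nat.add (Nat.mul 18 a) b))) 32

/-- Whether `a`, `b` and `c` are the points of a line. -/
def lineOK (T a b c : ℕ) : Bool :=
  Nat.beq (third T a b) (Nat.succ c) && Nat.beq (third T b a) (Nat.succ c) &&
    Nat.beq (third T a c) (Nat.succ b) && Nat.beq (third T c a) (Nat.succ b) &&
    Nat.beq (third T b c) (Nat.succ a) && Nat.beq (third T c b) (Nat.succ a)

/-- Whether all lines of a net satisfy `P`. -/
def allLines (m R : ℕ) (P : ℕ → ℕ → ℕ → Bool) : Bool :=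
  (List.range 6).all fun x => (List.range 6).all fun y =>
    (Nat.blt x m && Nat.blt y m) || P x (6 + y) (12 + cell R x y)

/-- Whether `{p, q, r}` is a line of a net. -/
def isLine (m R p q r : ℕ) : Bool :=
  !allLines m R fun a b c => !(
    (Nat.beq p a && ((Nat.beq q b && Nat.beq r c) || (Nat.beq q c && Nat.beq r b))) ||
    (Nat.beq p b && ((Nat.beq q a && Nat.beq r c) || (Nat.beq q c && Nat.beq r a))) ||
    (Nat.beq p c && ((Nat.beq q a && Nat.beq r b) || (Nat.beq q b && Nat.beq r a))))

/-- The image of the point `p` under a partial map. -/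
def get (f : List (ℕ × ℕ)) (p : ℕ) : ℕ :=
  List.rec 0 (fun a _ n => Bool.rec n a.2 (Nat.beq a.1 p)) f

/-- Whether `v` is the image of a point different from `r`. -/
def clash (f : List (ℕ × ℕ)) (r v : ℕ) : Bool :=
  List.rec false (fun a _ b => Bool.rec b (Bool.rec true b (Nat.beq a.1 r)) (Nat.beq a.2 v)) f

/-- The possible images of the point `r` under an isomorphism. -/
def images (m r : ℕ) : List ℕ :=
  (List.range 18).filter fun v => (Nat.blt (v % 6) m) == (Nat.blt (r % 6) m)

/-- Depth-first search for isomorphisms from a net with the generation `t` to a net with the table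
`T` of third points. -/
noncomputable def isoSearch (m T : ℕ) (good : List (ℕ × ℕ) → Bool) (t : List (ℕ × ℕ × ℕ)) :
    List (ℕ × ℕ) → Bool :=
  List.rec good (fun s _ next f =>
    -- The `false` case comes first: for `p ≠ r` the image of `r` is forced, and the value `0` (no
    -- line through the two images) closes the branch successfully. For `p = r` all images on the
    -- same side of the hole are tried.
    Bool.rec
      (Nat.rec true (fun v _ => clash f s.1 v || next ((s.1, v) :: f))
        (third T (get f s.2.1) (get f s.2.2)))
      ((images m s.1).all fun v => clash f s.1 v || next ((s.1, v) :: f))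
      (Nat.beq s.2.1 s.1)) t

/-- Whether `t` is a generation of a net, after the points `vis`. -/
def isGeneration (m R : ℕ) : List (ℕ × ℕ × ℕ) → List ℕ → Bool
  | [], vis => (List.range 18).all fun p => vis.elem p
  | (r, p, q) :: t, vis => Nat.blt r 18 &&
      (Nat.beq p r || (vis.elem p && vis.elem q && isLine m R p q r)) &&
      isGeneration m R t (r :: vis)

/-- For each net `M i`, a list of all points. A triple `(r, p, q)` with `p ≠ r` says that the point
`r` is on a line with the points `p` and `q`, which precede it. -/
def generation : List (List (ℕ × ℕ × ℕ)) :=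
  [[(0, 0, 0), (9, 9, 9), (15, 0, 9), (1, 1, 1), (16, 1, 9), (10, 1, 15), (2, 10, 16), (11, 2, 15),
    (17, 0, 10), (3, 3, 3), (6, 3, 15), (7, 3, 16), (8, 3, 17), (12, 3, 9), (13, 3, 10), (14, 3, 11),
    (4, 6, 17), (5, 6, 16)],
   [(0, 0, 0), (9, 9, 9), (15, 0, 9), (1, 1, 1), (17, 1, 9), (10, 1, 15), (2, 10, 17), (11, 2, 15),
    (16, 0, 10), (3, 3, 3), (6, 3, 15), (7, 3, 16), (8, 3, 17), (12, 3, 9), (14, 3, 10), (13, 3, 11),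
    (4, 6, 16), (5, 6, 17)],
   [(0, 0, 0), (8, 8, 8), (14, 0, 8), (7, 7, 7), (3, 7, 14), (17, 3, 8), (4, 7, 17), (12, 4, 8),
    (10, 4, 14), (16, 0, 10), (11, 0, 17), (1, 10, 17), (2, 8, 16), (9, 2, 17), (13, 2, 11), (6, 4, 16),
    (15, 4, 11), (5, 6, 17)],
   [(0, 0, 0), (8, 8, 8), (14, 0, 8), (7, 7, 7), (4, 7, 14), (17, 4, 8), (11, 0, 17), (3, 7, 17),
    (13, 3, 8), (1, 1, 1), (15, 1, 8), (9, 1, 14), (10, 1, 17), (16, 1, 11), (2, 7, 16), (12, 2, 8),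
    (6, 3, 15), (5, 6, 17)],
   [(0, 0, 0), (8, 8, 8), (14, 0, 8), (6, 6, 6), (2, 6, 14), (16, 2, 8), (4, 6, 16), (13, 4, 8),
    (10, 4, 14), (12, 2, 10), (11, 2, 13), (3, 10, 13), (9, 4, 12), (15, 4, 11), (5, 8, 12), (17, 0, 11),
    (1, 8, 15), (7, 2, 15)],
   [(0, 0, 0), (8, 8, 8), (14, 0, 8), (7, 7, 7), (4, 7, 14), (17, 4, 8), (11, 0, 17), (3, 7, 17),
    (16, 3, 8), (6, 4, 16), (15, 4, 11), (5, 6, 17), (13, 5, 8), (9, 5, 16), (10, 5, 14), (12, 5, 11),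
    (1, 8, 15), (2, 6, 14)],
   [(0, 0, 0), (8, 8, 8), (14, 0, 8), (7, 7, 7), (4, 7, 14), (17, 4, 8), (11, 0, 17), (3, 7, 17),
    (13, 3, 8), (9, 4, 13), (12, 4, 11), (5, 9, 12), (10, 5, 14), (15, 0, 9), (16, 0, 10), (1, 8, 15),
    (2, 7, 16), (6, 3, 15)],
   [(1, 1, 1), (8, 8, 8), (15, 1, 8), (6, 6, 6), (3, 6, 15), (16, 3, 8), (4, 6, 16), (7, 4, 15),
    (17, 4, 8), (5, 6, 17), (14, 5, 7), (13, 5, 8), (9, 5, 16), (10, 5, 15), (0, 8, 14), (11, 0, 17),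
    (2, 6, 14), (12, 2, 8)],
   [(0, 0, 0), (8, 8, 8), (14, 0, 8), (7, 7, 7), (4, 7, 14), (17, 4, 8), (11, 0, 17), (3, 7, 17),
    (16, 3, 8), (10, 3, 14), (13, 3, 11), (6, 4, 16), (9, 4, 13), (15, 4, 10), (12, 4, 11), (5, 6, 17),
    (1, 8, 15), (2, 6, 14)],
   [(0, 0, 0), (10, 10, 10), (16, 0, 10), (6, 6, 6), (4, 6, 16), (14, 4, 10), (8, 0, 14), (2, 6, 14),
    (7, 2, 16), (12, 2, 8), (15, 2, 10), (3, 6, 15), (17, 3, 7), (9, 3, 12), (13, 3, 10), (11, 3, 14),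
    (5, 6, 17), (1, 8, 15)],
   [(1, 1, 1), (8, 8, 8), (15, 1, 8), (7, 7, 7), (2, 7, 15), (16, 2, 8), (3, 7, 16), (17, 3, 8),
    (4, 7, 17), (12, 4, 8), (11, 4, 15), (5, 11, 12), (0, 11, 17), (10, 1, 17), (9, 2, 17), (13, 2, 11),
    (6, 3, 15), (14, 3, 11)],
   [(0, 0, 0), (8, 8, 8), (14, 0, 8), (6, 6, 6), (2, 6, 14), (16, 2, 8), (4, 6, 16), (13, 4, 8),
    (11, 4, 14), (10, 0, 16), (17, 0, 11), (1, 10, 17), (9, 2, 17), (12, 2, 10), (3, 8, 17), (7, 4, 17),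
    (15, 4, 10), (5, 6, 17)],
   [(0, 0, 0), (8, 8, 8), (14, 0, 8), (1, 1, 1), (15, 1, 8), (11, 1, 14), (4, 11, 15), (9, 0, 15),
    (17, 0, 11), (16, 1, 9), (10, 1, 17), (2, 9, 17), (13, 2, 10), (3, 8, 16), (12, 3, 9), (6, 4, 16),
    (7, 4, 14), (5, 6, 17)],
   [(0, 0, 0), (8, 8, 8), (14, 0, 8), (7, 7, 7), (5, 7, 14), (16, 5, 8), (10, 0, 16), (2, 7, 16),
    (12, 2, 8), (13, 2, 10), (3, 8, 13), (9, 3, 16), (11, 3, 14), (4, 9, 12), (15, 5, 10), (17, 0, 11),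
    (1, 8, 15), (6, 2, 14)],
   [(0, 0, 0), (8, 8, 8), (14, 0, 8), (7, 7, 7), (5, 7, 14), (16, 5, 8), (10, 0, 16), (2, 7, 16),
    (12, 2, 8), (13, 2, 10), (3, 8, 13), (9, 3, 16), (11, 3, 12), (4, 9, 13), (15, 5, 10), (17, 0, 11),
    (1, 8, 15), (6, 2, 14)],
   [(0, 0, 0), (8, 8, 8), (14, 0, 8), (1, 1, 1), (15, 1, 8), (11, 1, 14), (5, 11, 15), (9, 0, 15),
    (17, 0, 11), (16, 1, 9), (10, 1, 17), (2, 9, 17), (13, 2, 10), (3, 8, 17), (12, 3, 9), (4, 8, 13),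
    (6, 5, 17), (7, 5, 14)]]

/-- Whether each isomorphism from `M i` to `M j` passes the test `good`. -/
noncomputable def isoTest (i j : ℕ) (good : List (ℕ × ℕ) → Bool) : Bool :=
  force (tables.getD i 0) fun R => force (thirdTable (holeSize j) (tables.getD j 0)) fun T =>
    -- A map which breaks some line is no isomorphism, so `good` is required only of maps which
    -- preserve all lines.
    isoSearch (holeSize j) T (fun f => good f || !allLines (holeSize i) R fun a b c =>
      Nat.beq (third T (get f a) (get f b)) (Nat.succ (get f c))) (generation.getD i []) []

theorem isGeneration_generation : ∀ i < 16,
    isGeneration (holeSize i) (tables.getD i 0) (generation.getD i []) [] = true := by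
  decide +kernel

/-- The table is a sum of shifted entries; checking it on all lines replaces an argument that the
entries do not overlap. -/
theorem lineOK_thirdTable : ∀ j < 16, force (thirdTable (holeSize j) (tables.getD j 0)) (fun T =>
    allLines (holeSize j) (tables.getD j 0) (lineOK T)) = true := by
  decide +kernel

/-- No leaf can pass the test `false`, so success says that no branch ends in a map preserving all
lines. -/
theorem isoTest_false : ∀ i < 16, ∀ j < i, holeSize i = holeSize j →
    isoTest i j (fun _ => false) = true := by
  decide +kernel

/-! ### Correctness of the search for isomorphisms -/

theorem allLines_eq_true {m R : ℕ} {P : ℕ → ℕ → ℕ → Bool} : allLines m R P = true ↔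
    ∀ x < 6, ∀ y < 6, ¬ (x < m ∧ y < m) → P x (6 + y) (12 + cell R x y) = true := by
  simp only [allLines, List.all_eq_true, List.mem_range, Bool.or_eq_true, Bool.and_eq_true,
    Nat.blt_eq, or_iff_not_imp_left]

theorem lineOK_comm₁ {T a b c : ℕ} (h : lineOK T a b c = true) : lineOK T b a c = true := by
  simp only [lineOK, Bool.and_eq_true] at h ⊢
  tauto

theorem lineOK_comm₂ {T a b c : ℕ} (h : lineOK T a b c = true) : lineOK T a c b = true := by
  simp only [lineOK, Bool.and_eq_true] at h ⊢
  tauto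

/-- An isomorphism may permute the components differently from line to line, so the points of an
image line can appear in any order. -/
theorem lineOK_perm {T : ℕ} (P : Fin 3 → ℕ) (h : lineOK T (P 0) (P 1) (P 2) = true)
    {a b c : Fin 3} (hab : a ≠ b) (hac : a ≠ c) (hbc : b ≠ c) :
    lineOK T (P a) (P b) (P c) = true := by
  obtain ⟨rfl, rfl, rfl⟩ | ⟨rfl, rfl, rfl⟩ | ⟨rfl, rfl, rfl⟩ | ⟨rfl, rfl, rfl⟩ | ⟨rfl, rfl, rfl⟩ |
      ⟨rfl, rfl, rfl⟩ : (a = 0 ∧ b = 1 ∧ c = 2) ∨ (a = 0 ∧ b = 2 ∧ c = 1) ∨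
      (a = 1 ∧ b = 0 ∧ c = 2) ∨ (a = 1 ∧ b = 2 ∧ c = 0) ∨ (a = 2 ∧ b = 0 ∧ c = 1) ∨
      (a = 2 ∧ b = 1 ∧ c = 0) := by lia
  · exact h
  · exact lineOK_comm₂ h
  · exact lineOK_comm₁ h
  · exact lineOK_comm₂ (lineOK_comm₁ h)
  · exact lineOK_comm₁ (lineOK_comm₂ h)
  · exact lineOK_comm₂ (lineOK_comm₁ (lineOK_comm₂ h))

theorem lineOK_of_isLine {m R p q r T : ℕ} {E : ℕ → ℕ} (h : isLine m R p q r = true)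
    (hE : allLines m R (fun a b c => lineOK T (E a) (E b) (E c)) = true) :
    lineOK T (E p) (E q) (E r) = true := by
  rw [isLine, Bool.not_eq_true', Bool.eq_false_iff, ne_eq, allLines_eq_true] at h
  push Not at h
  obtain ⟨x, hx, y, hy, hxy, h⟩ := h
  rw [allLines_eq_true] at hE
  have hl := hE x hx y hy (by lia)
  simp only [ne_eq, Bool.not_eq_true', Bool.not_eq_false, Bool.or_eq_true, Bool.and_eq_true,
    Nat.beq_eq] at h
  rcases h with (⟨rfl, ⟨rfl, rfl⟩ | ⟨rfl, rfl⟩⟩ | ⟨rfl, ⟨rfl, rfl⟩ | ⟨rfl, rfl⟩⟩) |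
    ⟨rfl, ⟨rfl, rfl⟩ | ⟨rfl, rfl⟩⟩
  · exact hl
  · exact lineOK_comm₂ hl
  · exact lineOK_comm₁ hl
  · exact lineOK_comm₂ (lineOK_comm₁ hl)
  · exact lineOK_comm₁ (lineOK_comm₂ hl)
  · exact lineOK_comm₂ (lineOK_comm₁ (lineOK_comm₂ hl))

theorem get_eq {E : ℕ → ℕ} {f : List (ℕ × ℕ)} (hf : ∀ a ∈ f, a.2 = E a.1) {p : ℕ}
    (hp : p ∈ f.map Prod.fst) : get f p = E p := by
  induction f with
  | nil => simp at hp
  | cons a f ih =>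
    have hg : get (a :: f) p = Bool.rec (get f p) a.2 (Nat.beq a.1 p) := rfl
    rw [hg]
    cases hb : Nat.beq a.1 p with
    | true => rw [hf a List.mem_cons_self, (Nat.beq_eq ..).mp hb]
    | false =>
      refine ih (fun b hb => hf b (List.mem_cons_of_mem _ hb)) ?_
      rw [List.map_cons, List.mem_cons] at hp
      refine hp.resolve_left fun e => ?_
      have := (Nat.beq_eq ..).mpr e.symm
      rw [hb] at this
      exact absurd this (by decide)

theorem clash_eq_false {E : ℕ → ℕ} (hE : ∀ p < 18, ∀ q < 18, E p = E q → p = q)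
    {f : List (ℕ × ℕ)} (hf : ∀ a ∈ f, a.2 = E a.1 ∧ a.1 < 18) {r : ℕ} (hr : r < 18) :
    clash f r (E r) = false := by
  induction f with
  | nil => rfl
  | cons a f ih =>
    have hg : clash (a :: f) r (E r) = Bool.rec (clash f r (E r))
      (Bool.rec true (clash f r (E r)) (Nat.beq a.1 r)) (Nat.beq a.2 (E r)) := rfl
    rw [hg, ih fun b hb => hf b (List.mem_cons_of_mem _ hb)]
    obtain ⟨h2, h1⟩ := hf a List.mem_cons_self
    cases hb : Nat.beq a.2 (E r) with
    | false => rfl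
    | true =>
      have e := hE _ h1 _ hr (h2.symm.trans ((Nat.beq_eq ..).mp hb))
      rw [(Nat.beq_eq ..).mpr e]

/-- One follows the branch that assigns `E r` to each point `r`; the invariant is that `f` is `E`
restricted to the visited points. At a free point `E r` is among the candidates because `E`
preserves the hole, at a forced point it is the computed third point because `E` preserves lines,
and injectivity excludes a clash. -/
theorem exists_of_isoSearch {m R T : ℕ} {good : List (ℕ × ℕ) → Bool} {E : ℕ → ℕ}
    (hlt : ∀ p < 18, E p < 18) (hE : ∀ p < 18, ∀ q < 18, E p = E q → p = q)
    (hm : ∀ p < 18, E p % 6 < m ↔ p % 6 < m)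
    (hl : allLines m R (fun a b c => lineOK T (E a) (E b) (E c)) = true)
    (t : List (ℕ × ℕ × ℕ)) {vis : List ℕ} {f : List (ℕ × ℕ)}
    (ht : isGeneration m R t vis = true) (hv : f.map Prod.fst = vis)
    (hf : ∀ a ∈ f, a.2 = E a.1 ∧ a.1 < 18) (h : isoSearch m T good t f = true) :
    ∃ g, good g = true ∧ ∀ p < 18, get g p = E p := by
  induction t generalizing vis f with
  | nil =>
    refine ⟨f, h, fun p hp => get_eq (fun a ha => (hf a ha).1) ?_⟩
    simp only [isGeneration, List.all_eq_true, List.mem_range, List.elem_eq_contains,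
      List.contains_iff_mem] at ht
    rw [hv]
    exact ht p hp
  | cons s t ih =>
    obtain ⟨r, p, q⟩ := s
    simp only [isGeneration, Bool.and_eq_true, Nat.blt_eq, Bool.or_eq_true,
      List.elem_eq_contains, List.contains_iff_mem] at ht
    obtain ⟨⟨hr, ht₁⟩, ht⟩ := ht
    have next : (clash f r (E r) || isoSearch m T good t ((r, E r) :: f)) = true →
        ∃ g, good g = true ∧ ∀ p < 18, get g p = E p := by
      intro h'
      rw [clash_eq_false hE hf hr, Bool.false_or] at h'
      refine ih ht (by rw [List.map_cons, hv]) (fun a ha => ?_) h'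
      rcases List.mem_cons.1 ha with rfl | ha
      · exact ⟨rfl, hr⟩
      · exact hf a ha
    have h' : Bool.rec
      (Nat.rec true (fun v _ => clash f r v || isoSearch m T good t ((r, v) :: f))
        (third T (get f p) (get f q)))
      ((images m r).all fun v => clash f r v || isoSearch m T good t ((r, v) :: f))
      (Nat.beq p r) = true := h
    cases hb : Nat.beq p r with
    | true =>
      rw [hb] at h'
      have h'' := List.all_eq_true.1 h' (E r) (by
        simp only [images, List.mem_filter, List.mem_range, hlt r hr, true_and, beq_iff_eq]
        rw [Bool.eq_iff_iff, Nat.blt_eq, Nat.blt_eq]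
        exact hm r hr)
      exact next h''
    | false =>
      rw [hb] at h'
      have hpr : p ≠ r := fun e => by
        rw [(Nat.beq_eq ..).mpr e] at hb
        exact absurd hb (by decide)
      obtain ⟨⟨hp, hq⟩, hline⟩ := ht₁.resolve_left fun e => hpr ((Nat.beq_eq ..).mp e)
      rw [get_eq (fun a ha => (hf a ha).1) (hv ▸ hp), get_eq (fun a ha => (hf a ha).1) (hv ▸ hq)]
        at h'
      have hok := lineOK_of_isLine hline hl
      simp only [lineOK, Bool.and_eq_true, Nat.beq_eq] at hok
      rw [hok.1.1.1.1.1] at h'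
      exact next h'

/-- An isomorphism of nets maps the hole to the hole and the lines to lines. -/
theorem image_eq_of_net {m m' : ℕ} (hm : m = 2 ∨ m = 3) (hm' : m' = 2 ∨ m' = 3)
    {op op' : Fin 6 → Fin 6 → Fin 6} {e : Fin 18 ≃ Fin 18}
    (he : ∀ B, B ∈ net m op ↔ e '' B ∈ net m' op') :
    e '' hole m = hole m' ∧ ∀ x ∈ graph op, (∃ i, pt i (x i) ∉ hole m) → ∃ y ∈ graph op',
      (∃ i, pt i (y i) ∉ hole m') ∧
        e '' (Set.range fun i => pt i (x i)) = Set.range fun i => pt i (y i) := by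
  constructor
  -- The hole cannot become a line, having `3m > 3` points; the same count keeps lines from becoming
  -- the hole.
  · rcases (he (hole m)).1 (Or.inl rfl) with h | ⟨y, -, -, h⟩
    · exact h
    · have := congrArg Set.ncard h
      rw [Set.ncard_image_of_injective _ e.injective, ncard_hole (by lia), ncard_line] at this
      lia
  · intro x hx hout
    rcases (he (Set.range fun i => pt i (x i))).1 (Or.inr ⟨x, hx, hout, rfl⟩) with
      h | ⟨y, hy, hyo, h⟩
    · have := congrArg Set.ncard h
      rw [Set.ncard_image_of_injective _ e.injective, ncard_hole (by lia), ncard_line] at this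
      lia
    · exact ⟨y, hy, hyo, h⟩

theorem holeSize_eq (a : ℕ) : holeSize a = 2 ∨ holeSize a = 3 := by
  unfold holeSize
  cases Nat.ble (netNumbers.getD a 0) 1
  exacts [Or.inl rfl, Or.inr rfl]

theorem lineOK_thirdTable_pt {j : ℕ} (hj : j < 16) {y : Fin 3 → Fin 6}
    (hy : y ∈ graph (tableOp j)) (hyo : ∃ i, pt i (y i) ∉ hole (holeSize j)) {a b c : Fin 3}
    (hab : a ≠ b) (hac : a ≠ c) (hbc : b ≠ c) :
    lineOK (thirdTable (holeSize j) (tables.getD j 0)) (pt a (y a)) (pt b (y b)) (pt c (y c)) =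
      true := by
  have h := lineOK_thirdTable j hj
  rw [force_eq, allLines_eq_true] at h
  have h' := h (y 0) (y 0).isLt (y 1) (y 1).isLt fun hc => by
    obtain ⟨i, hi⟩ := hyo
    exact hi (pt_mem_hole.2 ((isHoley_tableOp j (by lia)).mem_hole_of_two hy
      (i := 0) (j := 1) (by decide) hc.1 hc.2 i))
  have hy' : tableOp j (y 0) (y 1) = y 2 := hy
  rw [cell_tables j (by lia), hy'] at h'
  have e0 : ((pt 0 (y 0) : Fin 18) : ℕ) = y 0 := by simp [pt_val]
  have e1 : ((pt 1 (y 1) : Fin 18) : ℕ) = 6 + y 1 := by simp [pt_val]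
  have e2 : ((pt 2 (y 2) : Fin 18) : ℕ) = 12 + y 2 := by simp [pt_val]
  rw [← e0, ← e1, ← e2] at h'
  exact lineOK_perm (fun i => (pt i (y i) : ℕ)) h' hab hac hbc

/-- The net which belongs to a Latin square in `tables`. -/
def tableNet (a : ℕ) : Set (Set (Fin 18)) := net (holeSize a) (tableOp a)

theorem holeSize_eq_of_isomorphic {i j : ℕ} (h : Isomorphic (tableNet i) (tableNet j)) :
    holeSize i = holeSize j := by
  obtain ⟨e, he⟩ := h
  have := congrArg Set.ncard (image_eq_of_net (holeSize_eq i) (holeSize_eq j) he).1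
  have hi := holeSize_eq i
  have hj := holeSize_eq j
  rw [Set.ncard_image_of_injective _ e.injective, ncard_hole (by lia), ncard_hole (by lia)] at this
  lia

/-- The values of `e` satisfy the hypotheses of `exists_of_isoSearch`. Since `e` preserves all
lines, the leaf which it reaches can only have been accepted by `good`. -/
theorem exists_of_isoTest {i j : ℕ} (hi : i < 16) (hj : j < 16) {good : List (ℕ × ℕ) → Bool}
    (h : isoTest i j good = true) (hh : holeSize i = holeSize j) {e : Fin 18 ≃ Fin 18}
    (he : ∀ B, B ∈ tableNet i ↔ e '' B ∈ tableNet j) :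
    ∃ f, good f = true ∧ ∀ p : Fin 18, get f p = e p := by
  let E : ℕ → ℕ := fun n => e (Fin.ofNat 18 n)
  have hEe : ∀ p : Fin 18, E p = e p := fun p => by simp [E]
  have hval : ∀ p : ℕ, p < 18 → ∃ q : Fin 18, p = q := fun p hp => ⟨⟨p, hp⟩, rfl⟩
  obtain ⟨hhole, hlines⟩ := image_eq_of_net (holeSize_eq i) (holeSize_eq j) he
  have hl : allLines (holeSize i) (tables.getD i 0) (fun a b c =>
      lineOK (thirdTable (holeSize j) (tables.getD j 0)) (E a) (E b) (E c)) = true := by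
    rw [allLines_eq_true]
    intro x hx y hy hxy
    let u : Fin 3 → Fin 6 := ![⟨x, hx⟩, ⟨y, hy⟩, tableOp i ⟨x, hx⟩ ⟨y, hy⟩]
    have huo : ∃ k, pt k (u k) ∉ hole (holeSize i) := by
      by_contra hc
      push Not at hc
      exact hxy ⟨pt_mem_hole.1 (hc 0), pt_mem_hole.1 (hc 1)⟩
    obtain ⟨w, hw, hwo, hew⟩ := hlines u rfl huo
    have hmem : ∀ k, ∃ a, e (pt k (u k)) = pt a (w a) := fun k => by
      have : e (pt k (u k)) ∈ Set.range fun a => pt a (w a) := hew ▸ ⟨_, ⟨k, rfl⟩, rfl⟩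
      obtain ⟨a, ha⟩ := this
      exact ⟨a, ha.symm⟩
    choose s hs using hmem
    have hsne : ∀ k l, k ≠ l → s k ≠ s l := fun k l hkl hc => by
      have := e.injective ((hs k).trans ((hc ▸ rfl : pt (s k) (w (s k)) = pt (s l) (w (s l))).trans
        (hs l).symm))
      exact hkl (pt_inj.1 this).1
    have hok := lineOK_thirdTable_pt hj hw hwo (hsne 0 1 (by decide)) (hsne 0 2 (by decide))
      (hsne 1 2 (by decide))
    rw [← hs, ← hs, ← hs, ← hEe, ← hEe, ← hEe] at hok
    have e0 : ((pt 0 (u 0) : Fin 18) : ℕ) = x := by simp [pt_val, u]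
    have e1 : ((pt 1 (u 1) : Fin 18) : ℕ) = 6 + y := by simp [pt_val, u]
    have e2 : ((pt 2 (u 2) : Fin 18) : ℕ) = 12 + cell (tables.getD i 0) x y := by
      rw [pt_val, show x = ((⟨x, hx⟩ : Fin 6) : ℕ) from rfl,
        show y = ((⟨y, hy⟩ : Fin 6) : ℕ) from rfl, cell_tables i (by lia)]
      rfl
    rwa [e0, e1, e2] at hok
  unfold isoTest at h
  rw [force_eq, force_eq, ← hh] at h
  rw [← hh] at hl
  obtain ⟨g, hg, hgE⟩ := exists_of_isoSearch (E := E) (fun p _ => (e _).isLt)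
    (fun p hp q hq hpq => by
      obtain ⟨p, rfl⟩ := hval p hp
      obtain ⟨q, rfl⟩ := hval q hq
      rw [hEe, hEe] at hpq
      exact congrArg Fin.val (e.injective (Fin.ext hpq)))
    (fun p hp => by
      obtain ⟨p, rfl⟩ := hval p hp
      rw [hEe]
      change e p ∈ hole (holeSize i) ↔ p ∈ hole (holeSize i)
      conv_lhs => rw [hh, ← hhole]
      exact e.injective.mem_set_image) hl _ (isGeneration_generation i hi) rfl
    (fun a ha => by simp at ha) h
  refine ⟨g, ?_, fun p => (hgE p p.isLt).trans (hEe p)⟩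
  rw [Bool.or_eq_true] at hg
  refine hg.resolve_right fun hc => ?_
  rw [Bool.not_eq_true', Bool.eq_false_iff, ne_eq, allLines_eq_true] at hc
  apply hc
  intro x hx y hy hxy
  have hok := allLines_eq_true.1 hl x hx y hy hxy
  simp only [lineOK, Bool.and_eq_true] at hok
  have hc18 : 12 + cell (tables.getD i 0) x y < 18 := by
    have := cell_tables i (by lia) ⟨x, hx⟩ ⟨y, hy⟩
    simp only at this
    lia
  rw [hgE x (by lia), hgE (6 + y) (by lia), hgE _ hc18]
  exact hok.1.1.1.1.1

/-- Different hole sizes are excluded by counting points, equal ones by the search; by symmetry the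
pairs `j < i` suffice. -/
theorem eq_of_isomorphic_tableNet {i j : ℕ} (hi : i < 16) (hj : j < 16)
    (h : Isomorphic (tableNet i) (tableNet j)) : i = j := by
  have key : ∀ i < 16, ∀ j < i, ¬ Isomorphic (tableNet i) (tableNet j) := by
    intro i hi j hji h
    have hh := holeSize_eq_of_isomorphic h
    obtain ⟨e, he⟩ := h
    obtain ⟨f, hf, -⟩ := exists_of_isoTest hi (by lia) (isoTest_false i hi j hji hh) hh he
    exact absurd hf (by decide)
  rcases lt_trichotomy i j with hij | hij | hij
  · exact (key j hj i hij h.symm).elim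
  · exact hij
  · exact (key i hi j hij h).elim

/-! ### Automorphism groups -/

/-- Generators of the automorphism groups of the nets `M i`, as lists of images. -/
def generators : List (List (List ℕ)) :=
  [[[0, 1, 2, 4, 5, 3, 7, 8, 6, 9, 10, 11, 13, 14, 12, 15, 16, 17],
    [1, 2, 0, 3, 4, 5, 6, 7, 8, 10, 11, 9, 13, 14, 12, 15, 16, 17],
    [1, 2, 0, 3, 4, 5, 7, 8, 6, 9, 10, 11, 12, 13, 14, 16, 17, 15],
    [6, 7, 8, 9, 10, 11, 12, 13, 14, 15, 16, 17, 0, 1, 2, 3, 4, 5],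
    [0, 2, 1, 3, 5, 4, 6, 8, 7, 9, 11, 10, 12, 14, 13, 15, 17, 16],
    [0, 1, 2, 3, 4, 5, 12, 13, 14, 15, 16, 17, 6, 7, 8, 9, 10, 11]],
   [[0, 1, 2, 4, 5, 3, 8, 6, 7, 9, 10, 11, 13, 14, 12, 15, 16, 17],
    [1, 2, 0, 3, 4, 5, 6, 7, 8, 10, 11, 9, 14, 12, 13, 15, 16, 17],
    [2, 0, 1, 3, 4, 5, 7, 8, 6, 9, 10, 11, 12, 13, 14, 16, 17, 15],
    [6, 7, 8, 9, 10, 11, 12, 13, 14, 15, 16, 17, 0, 1, 2, 3, 4, 5],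
    [0, 2, 1, 3, 5, 4, 6, 8, 7, 9, 11, 10, 12, 14, 13, 15, 17, 16],
    [0, 2, 1, 3, 4, 5, 12, 14, 13, 15, 16, 17, 6, 8, 7, 9, 10, 11]],
   [[0, 1, 4, 5, 2, 3, 6, 7, 10, 11, 8, 9, 12, 13, 16, 17, 14, 15],
    [1, 0, 5, 4, 3, 2, 12, 13, 14, 15, 16, 17, 7, 6, 9, 8, 11, 10],
    [6, 7, 8, 9, 10, 11, 12, 13, 16, 17, 14, 15, 0, 1, 4, 5, 2, 3],
    [12, 13, 14, 15, 16, 17, 6, 7, 10, 11, 8, 9, 0, 1, 2, 3, 4, 5]],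
   [[0, 1, 5, 4, 3, 2, 6, 7, 11, 10, 9, 8, 12, 13, 17, 16, 15, 14],
    [1, 0, 4, 2, 5, 3, 12, 13, 14, 15, 16, 17, 7, 6, 9, 8, 11, 10],
    [6, 7, 8, 9, 10, 11, 12, 13, 14, 16, 15, 17, 0, 1, 2, 4, 3, 5],
    [12, 13, 17, 16, 15, 14, 6, 7, 11, 9, 10, 8, 0, 1, 5, 4, 3, 2]],
   [[1, 0, 5, 4, 3, 2, 7, 6, 11, 10, 9, 8, 13, 12, 16, 17, 14, 15],
    [0, 1, 3, 2, 5, 4, 13, 12, 16, 17, 15, 14, 6, 7, 10, 11, 9, 8],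
    [6, 7, 9, 8, 11, 10, 12, 13, 16, 17, 15, 14, 0, 1, 4, 5, 3, 2],
    [13, 12, 17, 16, 14, 15, 7, 6, 8, 9, 10, 11, 1, 0, 4, 5, 3, 2]],
   [[1, 0, 3, 2, 5, 4, 7, 6, 10, 11, 8, 9, 13, 12, 17, 16, 15, 14],
    [0, 1, 4, 5, 3, 2, 12, 13, 16, 17, 15, 14, 6, 7, 10, 11, 9, 8],
    [6, 7, 9, 11, 10, 8, 12, 13, 15, 17, 16, 14, 0, 1, 3, 5, 4, 2],
    [12, 13, 14, 17, 16, 15, 6, 7, 8, 11, 10, 9, 0, 1, 2, 5, 4, 3]],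
   [[0, 1, 5, 4, 3, 2, 6, 7, 11, 10, 9, 8, 13, 12, 17, 16, 15, 14],
    [0, 1, 5, 4, 3, 2, 7, 6, 9, 8, 11, 10, 12, 13, 15, 14, 17, 16],
    [6, 7, 8, 10, 9, 11, 1, 0, 3, 5, 2, 4, 13, 12, 15, 17, 14, 16]],
   [[0, 1, 2, 3, 4, 5, 12, 13, 14, 15, 16, 17, 6, 7, 8, 9, 10, 11],
    [0, 1, 5, 4, 3, 2, 7, 6, 8, 9, 11, 10, 13, 12, 14, 15, 17, 16],
    [0, 1, 4, 5, 3, 2, 6, 7, 10, 11, 9, 8, 12, 13, 16, 17, 15, 14]],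
   [[0, 1, 2, 3, 4, 5, 7, 6, 10, 11, 8, 9, 13, 12, 16, 17, 14, 15],
    [0, 1, 2, 3, 5, 4, 12, 13, 14, 15, 16, 17, 6, 7, 8, 9, 10, 11],
    [1, 0, 4, 5, 3, 2, 13, 12, 14, 15, 16, 17, 7, 6, 9, 8, 11, 10]],
   [[0, 1, 2, 3, 4, 5, 12, 13, 14, 15, 17, 16, 6, 7, 8, 9, 11, 10],
    [0, 1, 5, 4, 3, 2, 7, 6, 8, 9, 11, 10, 13, 12, 14, 15, 17, 16],
    [1, 0, 5, 4, 2, 3, 6, 7, 10, 11, 9, 8, 12, 13, 17, 16, 14, 15]],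
   [[0, 1, 2, 5, 4, 3, 7, 6, 9, 8, 11, 10, 13, 12, 15, 14, 17, 16],
    [0, 1, 4, 5, 2, 3, 6, 7, 10, 11, 8, 9, 12, 13, 16, 17, 14, 15],
    [0, 1, 4, 3, 2, 5, 12, 13, 14, 15, 16, 17, 6, 7, 8, 9, 10, 11]],
   [[0, 1, 2, 5, 4, 3, 7, 6, 9, 8, 11, 10, 13, 12, 15, 14, 17, 16],
    [0, 1, 4, 3, 2, 5, 13, 12, 14, 15, 17, 16, 7, 6, 8, 9, 11, 10],
    [1, 0, 4, 3, 2, 5, 7, 6, 10, 11, 8, 9, 13, 12, 17, 16, 15, 14]],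
   [[6, 7, 11, 9, 8, 10, 12, 13, 17, 15, 14, 16, 0, 1, 5, 3, 2, 4],
    [0, 1, 4, 3, 2, 5, 12, 13, 16, 15, 14, 17, 6, 7, 10, 9, 8, 11]],
   [[1, 0, 3, 2, 5, 4, 6, 7, 8, 9, 10, 11, 13, 12, 15, 14, 17, 16],
    [12, 13, 17, 16, 15, 14, 6, 7, 11, 9, 10, 8, 0, 1, 5, 4, 3, 2]],
   [[0, 1, 4, 5, 2, 3, 7, 6, 9, 8, 10, 11, 13, 12, 15, 14, 16, 17],
    [0, 1, 2, 5, 4, 3, 12, 13, 14, 15, 16, 17, 6, 7, 8, 9, 10, 11]],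
   [[1, 0, 3, 2, 5, 4, 7, 6, 9, 8, 11, 10, 12, 13, 16, 15, 14, 17],
    [6, 7, 8, 9, 10, 11, 0, 1, 2, 3, 4, 5, 12, 13, 14, 15, 16, 17]]]

/-- The generators of the automorphism group of `M i`. -/
def gens (i : ℕ) : List (List ℕ) := generators.getD i []

/-- The `n`-th element of a list, or `0`. -/
def nth (l : List ℕ) : ℕ → ℕ :=
  List.rec (fun _ => 0) (fun a _ ih n => Nat.rec a (fun k _ => ih k) n) l

/-- `forceList l k` is `k l`, but `l` is evaluated before `k` is applied to it. -/
noncomputable def forceList {α : Type u} (l : List ℕ) : (List ℕ → α) → α :=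
  List.rec (fun k => k []) (fun a _ ih k => force a fun a => ih fun l => k (a :: l)) l

theorem forceList_eq {α : Type u} (l : List ℕ) (k : List ℕ → α) : forceList l k = k l := by
  induction l generalizing k with
  | nil => rfl
  | cons a l ih =>
    change force a (fun a => forceList l fun l => k (a :: l)) = _
    rw [force_eq, ih]

/-- The product of powers of the elements of a list with the given exponents. -/
def wordProd {G : Type u} [Monoid G] : List G → List ℕ → G
  | g :: l, e :: w => g ^ e * wordProd l w
  | _, _ => 1

/-- The image of `p` under a product of powers of maps. -/
def evalWord : List (List ℕ) → List ℕ → ℕ → ℕ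
  | h :: l, e :: w, p => Nat.rec (evalWord l w p) (fun _ q => nth h q) e
  | _, _, p => p

/-- Whether `h` is the list of images of a permutation. -/
def IsPermList (h : List ℕ) : Prop :=
  (∀ p : Fin 18, nth h p < 18) ∧ ∀ p q : Fin 18, nth h p = nth h q → p = q

instance (h : List ℕ) : Decidable (IsPermList h) := by
  unfold IsPermList
  infer_instance

open Classical in
/-- The permutation with the list of images `h`. -/
noncomputable def toPerm (h : List ℕ) : Equiv.Perm (Fin 18) :=
  if hh : IsPermList h then
    Equiv.ofBijective (fun p => ⟨nth h p, hh.1 p⟩)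
      (Finite.injective_iff_bijective.1 fun p q e => hh.2 p q (congrArg Fin.val e))
  else 1

/-! ### Words in the generators -/

theorem toPerm_apply {h : List ℕ} (hh : IsPermList h) (p : Fin 18) :
    (toPerm h p : ℕ) = nth h p := by
  rw [toPerm, dif_pos hh]
  rfl

theorem wordProd_toPerm {l : List (List ℕ)} (hl : ∀ h ∈ l, IsPermList h) (w : List ℕ)
    (p : Fin 18) : (wordProd (l.map toPerm) w p : ℕ) = evalWord l w p := by
  induction l generalizing w with
  | nil => rfl
  | cons h l ih =>
    cases w with
    | nil => rfl
    | cons e w =>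
      have ih' := ih (fun h hm => hl h (List.mem_cons_of_mem _ hm)) w
      have hh := hl h List.mem_cons_self
      change ((toPerm h ^ e * wordProd (l.map toPerm) w) p : ℕ) =
        Nat.rec (evalWord l w p) (fun _ q => nth h q) e
      induction e with
      | zero => simpa using ih'
      | succ e ihe =>
        rw [pow_succ', mul_assoc, Equiv.Perm.mul_apply, toPerm_apply hh, ihe]

theorem wordProd_mem {G : Type u} [Group G] (K : Subgroup G) {l : List G} (hl : ∀ g ∈ l, g ∈ K)
    (w : List ℕ) : wordProd l w ∈ K := by
  induction l generalizing w with
  | nil => exact K.one_mem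
  | cons g l ih =>
    cases w with
    | nil => exact K.one_mem
    | cons e w =>
      exact K.mul_mem (K.pow_mem (hl g List.mem_cons_self) e)
        (ih (fun g hg => hl g (List.mem_cons_of_mem _ hg)) w)

/-- Compatibility with left multiplication by single generators propagates to words. This makes a
map defined by normal forms a homomorphism without any presentation of the group. -/
theorem map_wordProd {G : Type u} {H : Type v} [Group G] [Group H] (φ : G → H) {s : List G}
    {l : List H} (h : List.Forall₂ (fun a b => ∀ g, φ (a * g) = b * φ g) s l) (w : List ℕ)
    (g : G) : φ (wordProd s w * g) = wordProd l w * φ g := by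
  induction h generalizing w with
  | nil => simp [wordProd]
  | @cons a b s l hab _ ih =>
    cases w with
    | nil => simp [wordProd]
    | cons e w =>
      simp only [wordProd]
      rw [mul_assoc, mul_assoc, ← ih]
      induction e with
      | zero => simp
      | succ e ihe => rw [pow_succ', pow_succ', mul_assoc, mul_assoc, hab, ihe]

/-- The induced map on the finite set of blocks is injective, hence surjective, so preserving blocks
in one direction is enough. -/
theorem mem_aut_of_forall {P : Type u} [Finite P] {M : Set (Set P)} {e : Equiv.Perm P}
    (h : ∀ B ∈ M, e '' B ∈ M) : e ∈ aut M := by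
  intro B
  refine ⟨h B, fun hB => ?_⟩
  let F : M → M := fun B => ⟨e '' B, h B B.2⟩
  have hF : Function.Injective F := fun B C hBC =>
    Subtype.ext (e.injective.image_injective (congrArg Subtype.val hBC))
  obtain ⟨⟨C, hC⟩, hCB⟩ := Finite.surjective_of_injective hF ⟨_, hB⟩
  rwa [← e.injective.image_injective (congrArg Subtype.val hCB)]

theorem range_fin_three {P : Type u} (f : Fin 3 → P) : Set.range f = {f 0, f 1, f 2} := by
  ext p
  simp [Fin.exists_fin_succ, eq_comm]

theorem exists_line_of_isLine {a : ℕ} (ha : a < 27) {p q r : Fin 18}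
    (h : isLine (holeSize a) (tables.getD a 0) p q r = true) : {p, q, r} ∈ tableNet a := by
  rw [isLine, Bool.not_eq_true', Bool.eq_false_iff, ne_eq, allLines_eq_true] at h
  push Not at h
  obtain ⟨x, hx, y, hy, hxy, h⟩ := h
  let u : Fin 3 → Fin 6 := ![⟨x, hx⟩, ⟨y, hy⟩, tableOp a ⟨x, hx⟩ ⟨y, hy⟩]
  have huo : ∃ k, pt k (u k) ∉ hole (holeSize a) := by
    by_contra hc
    push Not at hc
    exact absurd (pt_mem_hole.1 (hc 1)) (not_lt.2 (hxy (pt_mem_hole.1 (hc 0))))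
  have e0 : x = (pt 0 (u 0) : Fin 18) := by simp [pt_val, u]
  have e1 : 6 + y = (pt 1 (u 1) : Fin 18) := by simp [pt_val, u]
  have e2 : 12 + cell (tables.getD a 0) x y = (pt 2 (u 2) : Fin 18) := by
    rw [pt_val, show x = ((⟨x, hx⟩ : Fin 6) : ℕ) from rfl,
      show y = ((⟨y, hy⟩ : Fin 6) : ℕ) from rfl, cell_tables a ha]
    rfl
  rw [e2, e0, e1] at h
  simp only [ne_eq, Bool.not_eq_true', Bool.not_eq_false, Bool.or_eq_true, Bool.and_eq_true,
    Nat.beq_eq, Fin.val_inj] at h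
  refine Or.inr ⟨u, rfl, huo, ?_⟩
  rw [range_fin_three]
  ext z
  simp only [Set.mem_insert_iff, Set.mem_singleton_iff]
  rcases h with (⟨rfl, ⟨rfl, rfl⟩ | ⟨rfl, rfl⟩⟩ | ⟨rfl, ⟨rfl, rfl⟩ | ⟨rfl, rfl⟩⟩) |
    ⟨rfl, ⟨rfl, rfl⟩ | ⟨rfl, rfl⟩⟩ <;> tauto

theorem gens_spec : ∀ i < 16, ∀ h ∈ gens i, IsPermList h ∧
    (∀ p : Fin 18, nth h p % 6 < holeSize i ↔ (p : ℕ) % 6 < holeSize i) ∧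
    allLines (holeSize i) (tables.getD i 0) (fun a b c =>
      isLine (holeSize i) (tables.getD i 0) (nth h a) (nth h b) (nth h c)) = true := by
  decide +kernel

theorem toPerm_mem_aut {i : ℕ} (hi : i < 16) {h : List ℕ} (hh : h ∈ gens i) :
    toPerm h ∈ aut (tableNet i) := by
  obtain ⟨hp, hhole, hline⟩ := gens_spec i hi h hh
  refine mem_aut_of_forall ?_
  rintro B (rfl | ⟨u, hu, huo, rfl⟩)
  · refine Or.inl (Set.eq_of_subset_of_ncard_le ?_ ?_)
    · rintro _ ⟨p, hpm, rfl⟩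
      change (toPerm h p : ℕ) % 6 < holeSize i
      rw [toPerm_apply hp]
      exact (hhole p).2 hpm
    · rw [Set.ncard_image_of_injective _ (toPerm h).injective]
  · rw [← Set.range_comp, range_fin_three]
    refine exists_line_of_isLine (by lia) ?_
    have hout : ¬ ((u 0 : ℕ) < holeSize i ∧ (u 1 : ℕ) < holeSize i) := fun hc => by
      obtain ⟨k, hk⟩ := huo
      exact hk (pt_mem_hole.2 ((isHoley_tableOp i (by lia)).mem_hole_of_two hu
        (i := 0) (j := 1) (by decide) hc.1 hc.2 k))
    have := allLines_eq_true.1 hline (u 0) (u 0).isLt (u 1) (u 1).isLt hout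
    have hu' : tableOp i (u 0) (u 1) = u 2 := hu
    rw [cell_tables i (by lia), hu'] at this
    simp only [Function.comp_apply, toPerm_apply hp, pt_val]
    simpa using this

/-- Whether a partial map is one of the given words in the generators. -/
noncomputable def isWord (i : ℕ) (words : List (ℕ × ℕ) → List (List ℕ)) (f : List (ℕ × ℕ)) : Bool :=
  (words f).any fun w => forceList w fun w =>
    (List.range 18).all fun p => Nat.beq (evalWord (gens i) w p) (get f p)

/-- Whether the exponents `E` are compatible with the multiplication of `g` by generators. -/
noncomputable def mulTest {G : Type u} [Group G] (i : ℕ) (s : List G) (E : G → List ℕ)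
    (g : G) : Bool :=
  forceList (E g) fun w => (s.zip (gens i)).all fun a => forceList (E (a.1 * g)) fun w' =>
    (List.range 18).all fun p =>
      Nat.beq (evalWord (gens i) w' p) (nth a.2 (evalWord (gens i) w p))

/-- If the elements of the group `G` are words in some generators, and if the same words in
generators of the automorphism group of a net multiply in the same way, then the two groups are
isomorphic. -/
theorem nonempty_aut_mulEquiv {G : Type u} [Group G] {i : ℕ} (hi : i < 16) (s : List G)
    (E : G → List ℕ) (words : List (ℕ × ℕ) → List (List ℕ)) (hlen : s.length = (gens i).length)
    (hE : ∀ g, wordProd s (E g) = g) (hmul : ∀ g, mulTest i s E g = true)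
    (hone : ∀ p : Fin 18, evalWord (gens i) (E 1) p = p)
    (hinj : ∀ g, (∀ p : Fin 18, evalWord (gens i) (E g) p = p) → g = 1)
    (htest : isoTest i i (isWord i words) = true) : Nonempty (aut (tableNet i) ≃* G) := by
  have hperm : ∀ h ∈ gens i, IsPermList h := fun h hh => (gens_spec i hi h hh).1
  let l := (gens i).map toPerm
  let φ : G → Equiv.Perm (Fin 18) := fun g => wordProd l (E g)
  have hφ : ∀ g p, (φ g p : ℕ) = evalWord (gens i) (E g) p := fun g p =>
    wordProd_toPerm hperm _ p
  have hstep : List.Forall₂ (fun a b => ∀ g, φ (a * g) = b * φ g) s l := by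
    rw [List.forall₂_map_right_iff, List.forall₂_iff_zip]
    refine ⟨hlen, fun {a h} hah g => Equiv.ext fun p => Fin.ext ?_⟩
    have ht := hmul g
    simp only [mulTest, forceList_eq, List.all_eq_true, List.mem_range, Nat.beq_eq] at ht
    rw [Equiv.Perm.mul_apply, toPerm_apply (hperm h (List.of_mem_zip hah).2), hφ, hφ]
    exact ht (a, h) hah p p.isLt
  have hφ1 : φ 1 = 1 := Equiv.ext fun p => Fin.ext ((hφ 1 p).trans (hone p))
  have hφw : ∀ w, φ (wordProd s w) = wordProd l w := fun w => by
    have := map_wordProd φ hstep w 1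
    rwa [mul_one, hφ1, mul_one] at this
  -- Writing `g` as its normal form reduces the product to successive multiplications by generators.
  have hφmul : ∀ g g', φ (g * g') = φ g * φ g' := fun g g' => by
    conv_lhs => rw [← hE g]
    exact map_wordProd φ hstep (E g) g'
  have hmem : ∀ g, φ g ∈ aut (tableNet i) := fun g => by
    refine wordProd_mem _ (fun e he => ?_) _
    obtain ⟨h, hh, rfl⟩ := List.mem_map.1 he
    exact toPerm_mem_aut hi hh
  let ψ : G →* aut (tableNet i) :=
    MonoidHom.mk' (fun g => ⟨φ g, hmem g⟩) fun g g' => Subtype.ext (hφmul g g')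
  refine ⟨(MulEquiv.ofBijective ψ ⟨?_, ?_⟩).symm⟩
  · refine (injective_iff_map_eq_one ψ).2 fun g hg => hinj g fun p => ?_
    rw [← hφ, show φ g = 1 from congrArg Subtype.val hg]
    rfl
  -- Surjectivity: the search meets `e` and has checked that it equals a word in the generators; the
  -- same word in `s` is a preimage.
  · rintro ⟨e, he⟩
    obtain ⟨f, hf, hfe⟩ := exists_of_isoTest hi hi htest rfl (e := e) he
    obtain ⟨w, -, hw⟩ := List.any_eq_true.1 hf
    simp only [forceList_eq, List.all_eq_true, List.mem_range, Nat.beq_eq] at hw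
    refine ⟨wordProd s w, Subtype.ext (Equiv.ext fun p => Fin.ext ?_)⟩
    change (φ (wordProd s w) p : ℕ) = e p
    rw [hφw, wordProd_toPerm hperm, hw p p.isLt, hfe]

/-! ### The six types of automorphism groups -/

/-- The generator of the cyclic group of order `n`. -/
def gen (n : ℕ) : C n := Multiplicative.ofAdd 1

/-- The exponent of an element of the cyclic group of order `n`. -/
def expo {n : ℕ} (a : C n) : ℕ := (Multiplicative.toAdd a).val

/-- All words with exponents smaller than the given bounds. -/
def allWords : List ℕ → List (List ℕ)
  | [] => [[]]
  | n :: l => (List.range n).flatMap fun e => (allWords l).map fun w => e :: w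

/-- Generators of `C₂ × S₄`. -/
def gensS4 : List (C 2 × Equiv.Perm (Fin 4)) :=
  [(gen 2, 1), (1, finRotate 4), (1, Equiv.swap 0 1 * Equiv.swap 1 2), (1, Equiv.swap 0 1)]

/-- Exponents of the elements of `C₂ × S₄`. -/
def expoS4 (g : C 2 × Equiv.Perm (Fin 4)) : List ℕ :=
  -- Exponents along a chain of stabilizers: the 4-cycle `x ↦ x + 1` is used to send `3` to its
  -- image, then the 3-cycle on `{0, 1, 2}` to send `2` to its image, and a power of the
  -- transposition remains, read off at `0`.
  let i := ((g.2 3 : ℕ) + 1) % 4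
  let j := (((g.2 2 : ℕ) + 4 - i) % 4 + 1) % 3
  [expo g.1, i, j, (((g.2 0 : ℕ) + 4 - i) % 4 + 3 - j) % 3]

theorem nonempty_aut_mulEquiv_S4 : ∀ i : Fin 16, (i : ℕ) ∈ [2, 3, 4, 5] →
    Nonempty (aut (tableNet i) ≃* C 2 × Equiv.Perm (Fin 4)) := by
  have hlen : ∀ i ∈ [2, 3, 4, 5], gensS4.length = (gens i).length := by decide +kernel
  have hE : ∀ g, wordProd gensS4 (expoS4 g) = g := by decide +kernel
  have hmul : ∀ i ∈ [2, 3, 4, 5], ∀ g, mulTest i gensS4 expoS4 g = true := by decide +kernel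
  have hone : ∀ i ∈ [2, 3, 4, 5], ∀ p : Fin 18, evalWord (gens i) (expoS4 1) p = p := by
    decide +kernel
  have hinj : ∀ i ∈ [2, 3, 4, 5], ∀ g,
      (∀ p : Fin 18, evalWord (gens i) (expoS4 g) p = p) → g = 1 := by decide +kernel
  have htest : ∀ i ∈ [2, 3, 4, 5],
      isoTest i i (isWord i fun _ => allWords [2, 4, 3, 2]) = true := by decide +kernel
  exact fun i hi => nonempty_aut_mulEquiv i.isLt _ _ _ (hlen i hi) hE (hmul i hi) (hone i hi)
    (hinj i hi) (htest i hi)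

/-- Generators of `C₂ × D₈`. -/
def gensD8 : List (C 2 × DihedralGroup 4) :=
  [(gen 2, 1), (1, DihedralGroup.sr 0), (1, DihedralGroup.r 1)]

/-- Exponents of the elements of `C₂ × D₈`. -/
def expoD8 : C 2 × DihedralGroup 4 → List ℕ
  | (a, DihedralGroup.r i) => [expo a, 0, i.val]
  | (a, DihedralGroup.sr i) => [expo a, 1, i.val]

theorem nonempty_aut_mulEquiv_D8 : ∀ i : Fin 16, (i : ℕ) ∈ [6, 7, 8, 9] →
    Nonempty (aut (tableNet i) ≃* C 2 × DihedralGroup 4) := by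
  have hlen : ∀ i ∈ [6, 7, 8, 9], gensD8.length = (gens i).length := by decide +kernel
  have hE : ∀ g, wordProd gensD8 (expoD8 g) = g := by decide +kernel
  have hmul : ∀ i ∈ [6, 7, 8, 9], ∀ g, mulTest i gensD8 expoD8 g = true := by decide +kernel
  have hone : ∀ i ∈ [6, 7, 8, 9], ∀ p : Fin 18, evalWord (gens i) (expoD8 1) p = p := by
    decide +kernel
  have hinj : ∀ i ∈ [6, 7, 8, 9], ∀ g,
      (∀ p : Fin 18, evalWord (gens i) (expoD8 g) p = p) → g = 1 := by decide +kernel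
  have htest : ∀ i ∈ [6, 7, 8, 9],
      isoTest i i (isWord i fun _ => allWords [2, 2, 4]) = true := by decide +kernel
  exact fun i hi => nonempty_aut_mulEquiv i.isLt _ _ _ (hlen i hi) hE (hmul i hi) (hone i hi)
    (hinj i hi) (htest i hi)

/-- Generators of `C₂ × C₂ × C₂`. -/
def gensC2C2C2 : List (C 2 × C 2 × C 2) := [(gen 2, 1, 1), (1, gen 2, 1), (1, 1, gen 2)]

/-- Exponents of the elements of `C₂ × C₂ × C₂`. -/
def expoC2C2C2 (g : C 2 × C 2 × C 2) : List ℕ := [expo g.1, expo g.2.1, expo g.2.2]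

theorem nonempty_aut_mulEquiv_C2C2C2 : ∀ i : Fin 16, (i : ℕ) ∈ [10, 11] →
    Nonempty (aut (tableNet i) ≃* C 2 × C 2 × C 2) := by
  have hlen : ∀ i ∈ [10, 11], gensC2C2C2.length = (gens i).length := by decide +kernel
  have hE : ∀ g, wordProd gensC2C2C2 (expoC2C2C2 g) = g := by decide +kernel
  have hmul : ∀ i ∈ [10, 11], ∀ g, mulTest i gensC2C2C2 expoC2C2C2 g = true := by decide +kernel
  have hone : ∀ i ∈ [10, 11], ∀ p : Fin 18, evalWord (gens i) (expoC2C2C2 1) p = p := by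
    decide +kernel
  have hinj : ∀ i ∈ [10, 11], ∀ g,
      (∀ p : Fin 18, evalWord (gens i) (expoC2C2C2 g) p = p) → g = 1 := by decide +kernel
  have htest : ∀ i ∈ [10, 11],
      isoTest i i (isWord i fun _ => allWords [2, 2, 2]) = true := by decide +kernel
  exact fun i hi => nonempty_aut_mulEquiv i.isLt _ _ _ (hlen i hi) hE (hmul i hi) (hone i hi)
    (hinj i hi) (htest i hi)

/-- Generators of `S₃`. -/
def gensS3 : List (Equiv.Perm (Fin 3)) := [Equiv.swap 0 1 * Equiv.swap 1 2, Equiv.swap 0 1]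

/-- Exponents of the elements of `S₃`. -/
def expoS3 (g : Equiv.Perm (Fin 3)) : List ℕ :=
  let j := ((g 2 : ℕ) + 1) % 3
  [j, ((g 0 : ℕ) + 3 - j) % 3]

theorem nonempty_aut_mulEquiv_S3 : ∀ i : Fin 16, (i : ℕ) ∈ [12] →
    Nonempty (aut (tableNet i) ≃* Equiv.Perm (Fin 3)) := by
  have hlen : ∀ i ∈ [12], gensS3.length = (gens i).length := by decide +kernel
  have hE : ∀ g, wordProd gensS3 (expoS3 g) = g := by decide +kernel
  have hmul : ∀ i ∈ [12], ∀ g, mulTest i gensS3 expoS3 g = true := by decide +kernel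
  have hone : ∀ i ∈ [12], ∀ p : Fin 18, evalWord (gens i) (expoS3 1) p = p := by decide +kernel
  have hinj : ∀ i ∈ [12], ∀ g,
      (∀ p : Fin 18, evalWord (gens i) (expoS3 g) p = p) → g = 1 := by decide +kernel
  have htest : ∀ i ∈ [12],
      isoTest i i (isWord i fun _ => allWords [3, 2]) = true := by decide +kernel
  exact fun i hi => nonempty_aut_mulEquiv i.isLt _ _ _ (hlen i hi) hE (hmul i hi) (hone i hi)
    (hinj i hi) (htest i hi)

/-- Generators of `C₂ × C₂`. -/
def gensC2C2 : List (C 2 × C 2) := [(gen 2, 1), (1, gen 2)]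

/-- Exponents of the elements of `C₂ × C₂`. -/
def expoC2C2 (g : C 2 × C 2) : List ℕ := [expo g.1, expo g.2]

theorem nonempty_aut_mulEquiv_C2C2 : ∀ i : Fin 16, (i : ℕ) ∈ [13, 14, 15] →
    Nonempty (aut (tableNet i) ≃* C 2 × C 2) := by
  have hlen : ∀ i ∈ [13, 14, 15], gensC2C2.length = (gens i).length := by decide +kernel
  have hE : ∀ g, wordProd gensC2C2 (expoC2C2 g) = g := by decide +kernel
  have hmul : ∀ i ∈ [13, 14, 15], ∀ g, mulTest i gensC2C2 expoC2C2 g = true := by decide +kernel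
  have hone : ∀ i ∈ [13, 14, 15], ∀ p : Fin 18, evalWord (gens i) (expoC2C2 1) p = p := by
    decide +kernel
  have hinj : ∀ i ∈ [13, 14, 15], ∀ g,
      (∀ p : Fin 18, evalWord (gens i) (expoC2C2 g) p = p) → g = 1 := by decide +kernel
  have htest : ∀ i ∈ [13, 14, 15],
      isoTest i i (isWord i fun _ => allWords [2, 2]) = true := by decide +kernel
  exact fun i hi => nonempty_aut_mulEquiv i.isLt _ _ _ (hlen i hi) hE (hmul i hi) (hone i hi)
    (hinj i hi) (htest i hi)

/-- An element of `((C₃ × C₃ × C₃) : C₃) : (C₂ × C₂)`. -/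
def mk324 (a b c k : C 3) (ε δ : ℤˣ) : C3Cubed_C3_C2C2 :=
  ⟨⟨fun i => ![a, b, c] (Multiplicative.toAdd i : Fin 3), k⟩, (ε, δ)⟩

/-- Replacing a function on `C 3` by its three values turns a statement about the group into one
about six small finite factors, which can be enumerated. -/
theorem forall_mk324 {P : C3Cubed_C3_C2C2 → Prop} (h : ∀ a b c k ε δ, P (mk324 a b c k ε δ)) :
    ∀ g, P g := by
  rintro ⟨⟨f, k⟩, ε, δ⟩
  have := h (f (Multiplicative.ofAdd 0)) (f (Multiplicative.ofAdd 1)) (f (Multiplicative.ofAdd 2))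
    k ε δ
  have e : f = fun i => ![f (Multiplicative.ofAdd 0), f (Multiplicative.ofAdd 1),
      f (Multiplicative.ofAdd 2)] (Multiplicative.toAdd i : Fin 3) := by
    funext i
    obtain ⟨i, rfl⟩ := Multiplicative.ofAdd.surjective i
    change Fin 3 at i
    fin_cases i <;> rfl
  rw [e]
  exact this

/-- Generators of `((C₃ × C₃ × C₃) : C₃) : (C₂ × C₂)`. -/
def gens324 : List C3Cubed_C3_C2C2 :=
  [mk324 (gen 3) 1 1 1 1 1, mk324 1 (gen 3) 1 1 1 1, mk324 1 1 (gen 3) 1 1 1,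
    mk324 1 1 1 (gen 3) 1 1, mk324 1 1 1 1 (-1) 1, mk324 1 1 1 1 1 (-1)]

/-- The exponent of a sign. -/
def expoSign (ε : ℤˣ) : ℕ := if ε = 1 then 0 else 1

/-- Exponents of the elements of `((C₃ × C₃ × C₃) : C₃) : (C₂ × C₂)`. -/
def expo324 (g : C3Cubed_C3_C2C2) : List ℕ :=
  [expo (g.left.left (Multiplicative.ofAdd 0)), expo (g.left.left (Multiplicative.ofAdd 1)),
    expo (g.left.left (Multiplicative.ofAdd 2)), expo g.left.right, expoSign g.right.1,
    expoSign g.right.2]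

/-- The only word in the generators which may be a given automorphism. -/
def words324 (f : List (ℕ × ℕ)) : List (List ℕ) :=
  -- The points `3` and `9` have label `3` in the components `0` and `1`. Their images show the
  -- rotation `k` of the components and whether it is composed with a reflection (`d`); the images
  -- of `3` and `4` show the orientation of the labels (`e`).
  let k := get f 3 / 6
  let d := if (get f 9 / 6 + 3 - k) % 3 = 1 then 0 else 1
  let e := if (get f 4 + 3 - get f 3) % 3 = 1 then 0 else 1
  -- The component `j i` is the one mapped to component `i`. The sign generators fix the label `3`
  -- off the hole, so its image there gives the exponent `v i` of the rotation of the labels `3, 4,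
  -- 5` in component `i`.
  let j i := if d = 0 then (i + 3 - k) % 3 else (k + 3 - i) % 3
  let v i := get f (6 * j i + 3) % 6 - 3
  [[v 0, v 1, v 2, k, e, d]]

theorem expo_injective {n : ℕ} [NeZero n] : Function.Injective (expo : C n → ℕ) := fun _ _ h =>
  Multiplicative.toAdd.injective (ZMod.val_injective n h)

/-- Equalities in the semidirect product can thereby be decided on lists of numbers. -/
theorem expo324_injective : Function.Injective expo324 := by
  have hs : ∀ ε ε' : ℤˣ, expoSign ε = expoSign ε' → ε = ε' := by decide
  rintro ⟨⟨f, k⟩, ε, δ⟩ ⟨⟨f', k'⟩, ε', δ'⟩ h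
  simp only [expo324, List.cons.injEq, and_true] at h
  obtain ⟨h0, h1, h2, hk, hε, hδ⟩ := h
  have hf : f = f' := by
    funext i
    obtain ⟨i, rfl⟩ := Multiplicative.ofAdd.surjective i
    change Fin 3 at i
    fin_cases i
    exacts [expo_injective h0, expo_injective h1, expo_injective h2]
  rw [hf, expo_injective hk, hs _ _ hε, hs _ _ hδ]

theorem wordProd_expo324 (g : C3Cubed_C3_C2C2) : wordProd gens324 (expo324 g) = g := by
  have h : ∀ a b c k ε δ, expo324 (wordProd gens324 (expo324 (mk324 a b c k ε δ))) =
      expo324 (mk324 a b c k ε δ) := by decide +kernel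
  exact expo324_injective
    (forall_mk324 (P := fun g => expo324 (wordProd gens324 (expo324 g)) = expo324 g) h g)

theorem mulTest_324 : ∀ i ∈ [0, 1], ∀ g, mulTest i gens324 expo324 g = true := by
  have h : ∀ i ∈ [0, 1], ∀ a b c k ε δ,
      mulTest i gens324 expo324 (mk324 a b c k ε δ) = true := by decide +kernel
  exact fun i hi g => forall_mk324 (P := fun g => mulTest i gens324 expo324 g = true) (h i hi) g

theorem eq_one_of_evalWord_324 : ∀ i ∈ [0, 1], ∀ g,
    (∀ p : Fin 18, evalWord (gens i) (expo324 g) p = p) → g = 1 := by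
  have h : ∀ i ∈ [0, 1], ∀ a b c k ε δ,
      (∀ p : Fin 18, evalWord (gens i) (expo324 (mk324 a b c k ε δ)) p = p) →
      expo324 (mk324 a b c k ε δ) = expo324 1 := by decide +kernel
  exact fun i hi g hg => expo324_injective (forall_mk324 (P := fun g =>
    (∀ p : Fin 18, evalWord (gens i) (expo324 g) p = p) → expo324 g = expo324 1) (h i hi) g hg)

theorem nonempty_aut_mulEquiv_324 : ∀ i : Fin 16, (i : ℕ) ∈ [0, 1] →
    Nonempty (aut (tableNet i) ≃* C3Cubed_C3_C2C2) := by
  have hlen : ∀ i ∈ [0, 1], gens324.length = (gens i).length := by decide +kernel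
  have hone : ∀ i ∈ [0, 1], ∀ p : Fin 18, evalWord (gens i) (expo324 1) p = p := by decide +kernel
  have htest : ∀ i ∈ [0, 1], isoTest i i (isWord i words324) = true := by decide +kernel
  exact fun i hi => nonempty_aut_mulEquiv i.isLt _ _ _ (hlen i hi) wordProd_expo324
    (mulTest_324 i hi) (hone i hi) (eq_one_of_evalWord_324 i hi) (htest i hi)

/-! ### The classification -/

/-- A triple whose first two labels are in the hole lies entirely in the hole and contributes no
line, so the products inside the hole do not matter. -/
theorem net_congr {m : ℕ} {op op' : Fin 6 → Fin 6 → Fin 6} (h : IsHoley m op)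
    (h' : IsHoley m op') (he : ∀ x y : Fin 6, ¬ ((x : ℕ) < m ∧ (y : ℕ) < m) → op x y = op' x y) :
    net m op = net m op' := by
  have key : ∀ {op op' : Fin 6 → Fin 6 → Fin 6}, IsHoley m op →
      (∀ x y : Fin 6, ¬ ((x : ℕ) < m ∧ (y : ℕ) < m) → op x y = op' x y) →
      net m op ⊆ net m op' := by
    rintro op op' h he B (rfl | ⟨x, hx, hxo, rfl⟩)
    · exact Or.inl rfl
    · have hx' : op (x 0) (x 1) = x 2 := hx
      refine Or.inr ⟨x, ?_, hxo, rfl⟩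
      change op' (x 0) (x 1) = x 2
      rw [← he, hx']
      rintro ⟨h0, h1⟩
      obtain ⟨k, hk⟩ := hxo
      exact hk (pt_mem_hole.2 (h.mem_hole_of_two hx (i := 0) (j := 1) (by decide) h0 h1 k))
  exact (key h he).antisymm (key h' fun x y hxy => (he x y hxy).symm)

theorem netNumbers_spec : ∀ a < 27, ∃ i : Fin 16, (i : ℕ) = netNumbers.getD a 0 ∧
    holeSize a = holeSize i ∧ ∀ x y : Fin 6, ¬ ((x : ℕ) < holeSize a ∧ (y : ℕ) < holeSize a) →
      tableOp a x y = tableOp i x y := by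
  decide +kernel

theorem exists_tableNet_eq {a : ℕ} (ha : a < 27) :
    ∃ i : Fin 16, (i : ℕ) = netNumbers.getD a 0 ∧ tableNet a = tableNet i := by
  obtain ⟨i, hi, hh, he⟩ := netNumbers_spec a ha
  refine ⟨i, hi, ?_⟩
  have h' := isHoley_tableOp i (by lia)
  unfold tableNet
  rw [← hh] at h' ⊢
  exact net_congr (isHoley_tableOp a ha) h' he

theorem isQuasigroup_denesKeedwell (k : Fin 12) : IsQuasigroup (denesKeedwell k) := by
  have h₁ : ∀ k, ∀ x y y', denesKeedwell k x y = denesKeedwell k x y' → y = y' := by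
    decide +kernel
  have h₂ : ∀ k, ∀ x x' y, denesKeedwell k x y = denesKeedwell k x' y → x = x' := by
    decide +kernel
  exact ⟨fun x => Finite.injective_iff_bijective.1 fun y y' => h₁ k x y y',
    fun y => Finite.injective_iff_bijective.1 fun x x' => h₂ k x x' y⟩

/-- The finite check shows only that triples go to triples; `graph_iff_of_forall` supplies the
converse. -/
theorem exists_isostrophic_denesKeedwell {a : ℕ} (ha : a < 27) :
    ∃ k : Fin 12, (k : ℕ) = mainClasses.getD a 0 ∧ Isostrophic (tableOp a) (denesKeedwell k) := by
  obtain ⟨k, hk, h⟩ := mainClassMaps_spec ⟨a, ha⟩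
  refine ⟨k, hk, ?_⟩
  generalize mainClassMaps.getD _ _ = t at h
  obtain ⟨ρ, g₀, g₁, g₂⟩ := t
  obtain ⟨hρ, h₀, h₁, h₂, h⟩ := h
  rw [force_eq] at h
  obtain ⟨τ, hτ⟩ := hρ.exists_perm
  obtain ⟨γ₀, e₀⟩ := h₀.exists_perm
  obtain ⟨γ₁, e₁⟩ := h₁.exists_perm
  obtain ⟨γ₂, e₂⟩ := h₂.exists_perm
  let γ : Fin 3 → Equiv.Perm (Fin 6) := ![γ₀, γ₁, γ₂]
  have hT := mapsTriples_sound h (cell_tables a ha) (cell_pack _) (τ := τ) hτ (γ := γ) e₀ e₁ e₂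
  have hq := isQuasigroup_denesKeedwell k
  exact ⟨τ.symm, γ, graph_iff_of_forall hq τ.symm γ hT⟩

theorem labelingNumbers_spec : ∀ a < 27, ∀ i : Fin 16, ∀ k : Fin 12, (i : ℕ) = netNumbers.getD a 0 →
    (k : ℕ) = mainClasses.getD a 0 → (k : ℕ) + 1 ∈ labelingNumbers i := by
  decide +kernel

/-- Together with `labelingNumbers_spec` this says that the listed numbers are exactly the main
classes of the tables with net `i`. -/
theorem exists_of_mem_labelingNumbers : ∀ i : Fin 16, ∀ k : Fin 12,
    (k : ℕ) + 1 ∈ labelingNumbers i →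
      ∃ a < 27, (i : ℕ) = netNumbers.getD a 0 ∧ (k : ℕ) = mainClasses.getD a 0 := by
  decide +kernel

theorem superlineLength_eq : ∀ i : Fin 16, superlineLength i = holeSize i := by decide

/-- The classification of the light dual multinets of order `6` with a unique superline, together
with the main class of the labeling quasigroup. -/
theorem IsLabeling.exists_tableNet {Q : Type u} {P : Type v} {op : Q → Q → Q}
    {α : Fin 3 → Q → P} {N : Set (Set P)} (hQ : Nat.card Q = 6) (h : IsLabeling op α N)
    (hu : ∃! B, IsSuperline α N B) : ∃ i : Fin 16, Isomorphic N (tableNet i) ∧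
      ∃ k : Fin 12, (k : ℕ) + 1 ∈ labelingNumbers i ∧ Isostrophic op (denesKeedwell k) := by
  obtain ⟨m, hm, op', hloop, hop, hN⟩ := h.exists_isHoleyLoop hQ hu
  obtain ⟨a, ha, rfl, hop', hN'⟩ := hloop.exists_tableOp hm
  obtain ⟨i, hi, hia⟩ := exists_tableNet_eq ha
  obtain ⟨k, hk, hka⟩ := exists_isostrophic_denesKeedwell ha
  refine ⟨i, ?_, k, labelingNumbers_spec a ha i k hi hk, (hop.trans hop').trans hka⟩
  rw [← hia]
  exact hN.trans hN'

theorem isLabeling_tableNet {a : ℕ} (ha : a < 27) : IsLabeling (tableOp a) pt (tableNet a) := by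
  have := holeSize_eq a
  exact (isHoley_tableOp a ha).isLabeling (by lia) (by lia)

theorem isSuperline_tableNet_iff {Q : Type u} {a : ℕ} {op : Q → Q → Q} {α : Fin 3 → Q → Fin 18}
    (h : IsLabeling op α (tableNet a)) {B : Set (Fin 18)} :
    IsSuperline α (tableNet a) B ↔ B = hole (holeSize a) := by
  have := holeSize_eq a
  have := h.finite_of_fin
  exact isSuperline_net_iff (by lia) (by lia) h

theorem existsUnique_isSuperline_tableNet {Q : Type u} {a : ℕ} {op : Q → Q → Q}
    {α : Fin 3 → Q → Fin 18} (h : IsLabeling op α (tableNet a)) :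
    ∃! B, IsSuperline α (tableNet a) B :=
  ⟨_, (isSuperline_tableNet_iff h).2 rfl, fun _ hB => (isSuperline_tableNet_iff h).1 hB⟩

/-- A labeling of `M i` is itself subject to the classification, which returns some `M j` isomorphic
to `M i` and a main class listed for `j`; nonisomorphism forces `j = i`. Conversely, a table with
net `M i` and the given main class passes its labeling on along the isostrophism. -/
theorem exists_isLabeling_tableNet_iff (i : Fin 16) {Q : Type u} {op : Q → Q → Q}
    (hq : IsQuasigroup op) : (∃ α : Fin 3 → Q → Fin 18, IsLabeling op α (tableNet i)) ↔
      ∃ k : Fin 12, (k : ℕ) + 1 ∈ labelingNumbers i ∧ Isostrophic op (denesKeedwell k) := by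
  constructor
  · rintro ⟨α, h⟩
    obtain ⟨j, hij, hk⟩ := h.exists_tableNet h.card_eq_six (existsUnique_isSuperline_tableNet h)
    obtain rfl : i = j := Fin.ext (eq_of_isomorphic_tableNet i.isLt j.isLt hij)
    exact hk
  · rintro ⟨k, hk, hop⟩
    obtain ⟨a, ha, hi, hka⟩ := exists_of_mem_labelingNumbers i k hk
    obtain ⟨i', hi', hia⟩ := exists_tableNet_eq ha
    obtain rfl : i = i' := Fin.ext (hi.trans hi'.symm)
    obtain ⟨k', hk', hak⟩ := exists_isostrophic_denesKeedwell ha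
    obtain rfl : k = k' := Fin.ext (hka.trans hk'.symm)
    rw [← hia]
    exact (isLabeling_tableNet ha).of_isostrophic hq (hop.trans hak.symm)

end LDM

theorem mainTheorem1 :
    ∃ M : Fin 16 → Set (Set (Fin 18)),
      -- each `M i` is an abstract light dual multinet of order `6` with a unique superline
      (∀ i, ∃ (op : Fin 6 → Fin 6 → Fin 6) (α : Fin 3 → Fin 6 → Fin 18),
        LDM.IsLabeling op α (M i) ∧ ∃! B, LDM.IsSuperline α (M i) B) ∧
      -- they are pairwise nonisomorphic
      (∀ i j, LDM.Isomorphic (M i) (M j) → i = j) ∧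
      -- every abstract light dual multinet of order `6` with a unique superline is among them
      (∀ (P : Type*) (Q : Type*) (op : Q → Q → Q) (α : Fin 3 → Q → P) (N : Set (Set P)),
        Nat.card Q = 6 → LDM.IsLabeling op α N → (∃! B, LDM.IsSuperline α N B) →
          ∃ i, LDM.Isomorphic N (M i)) ∧
      -- (A) the length of the superline, with respect to any labeling
      (∀ (i : Fin 16) (Q : Type*) (op : Q → Q → Q) (α : Fin 3 → Q → Fin 18),
        LDM.IsLabeling op α (M i) →
          ∃ B, LDM.IsSuperline α (M i) B ∧ LDM.length α B = LDM.superlineLength i ∧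
            ∀ B', LDM.IsSuperline α (M i) B' → B' = B) ∧
      -- (B) the main classes of the labeling quasigroups
      (∀ (i : Fin 16) (Q : Type*) (op : Q → Q → Q), LDM.IsQuasigroup op →
        ((∃ α : Fin 3 → Q → Fin 18, LDM.IsLabeling op α (M i)) ↔
          ∃ k : Fin 12, (k : ℕ) + 1 ∈ LDM.labelingNumbers i ∧
            LDM.Isostrophic op (LDM.denesKeedwell k))) ∧
      -- the automorphism groups
      (∀ i ∈ ({0, 1} : Set (Fin 16)), Nonempty (LDM.aut (M i) ≃* LDM.C3Cubed_C3_C2C2)) ∧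
      (∀ i ∈ ({2, 3, 4, 5} : Set (Fin 16)),
        Nonempty (LDM.aut (M i) ≃* LDM.C 2 × Equiv.Perm (Fin 4))) ∧
      (∀ i ∈ ({6, 7, 8, 9} : Set (Fin 16)),
        Nonempty (LDM.aut (M i) ≃* LDM.C 2 × DihedralGroup 4)) ∧
      (∀ i ∈ ({10, 11} : Set (Fin 16)),
        Nonempty (LDM.aut (M i) ≃* LDM.C 2 × LDM.C 2 × LDM.C 2)) ∧
      (∀ i ∈ ({12} : Set (Fin 16)), Nonempty (LDM.aut (M i) ≃* Equiv.Perm (Fin 3))) ∧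
      (∀ i ∈ ({13, 14, 15} : Set (Fin 16)),
        Nonempty (LDM.aut (M i) ≃* LDM.C 2 × LDM.C 2)) := by
  refine ⟨fun i => LDM.tableNet i, fun i => ?_, fun i j h => ?_, fun P Q op α N hQ h hu => ?_,
    fun i Q op α h => ?_, fun i Q op hq => LDM.exists_isLabeling_tableNet_iff i hq,
    fun i hi => LDM.nonempty_aut_mulEquiv_324 i ?_, fun i hi => LDM.nonempty_aut_mulEquiv_S4 i ?_,
    fun i hi => LDM.nonempty_aut_mulEquiv_D8 i ?_,
    fun i hi => LDM.nonempty_aut_mulEquiv_C2C2C2 i ?_,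
    fun i hi => LDM.nonempty_aut_mulEquiv_S3 i ?_, fun i hi => LDM.nonempty_aut_mulEquiv_C2C2 i ?_⟩
  · have h := LDM.isLabeling_tableNet (a := i) (by lia)
    exact ⟨_, _, h, LDM.existsUnique_isSuperline_tableNet h⟩
  · exact Fin.ext (LDM.eq_of_isomorphic_tableNet i.isLt j.isLt h)
  · obtain ⟨i, hi, -⟩ := h.exists_tableNet hQ hu
    exact ⟨i, hi⟩
  · have hs := fun B => LDM.isSuperline_tableNet_iff h (B := B)
    have := h.finite_of_fin
    have hl := LDM.holeSize_eq i
    refine ⟨_, (hs _).2 rfl, ?_, fun B' hB' => (hs B').1 hB'⟩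
    rw [LDM.superlineLength_eq]
    exact LDM.length_hole (by lia) h
  all_goals
    simp only [Set.mem_insert_iff, Set.mem_singleton_iff] at hi
    revert i
    decide
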